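/- Let $n\ge 1$. Let $L(n)$ be the set of formal iterated binary bracket expressions in the symbols $x_1,\dots,x_n$ in which each symbol appears exactly once and such that, inside every bracket, the symbol of smallest index lies in the left-hand side and the symbol of largest index lies in the right-hand side. A bracket is called connected if the set of indices of the symbols inside it is an interval of consecutive integers, and an expression of $L(n)$ is called prime if it is a bracket and its outer bracket is the only connected bracket that it contains. Let $P(n)\subset L(n)$ be the set of prime expressions (the operadic generators of $\mathrm{Lie}$ in arity $n$), and let $b_n=|P(n)|$. For a nontrivial commutative ring $R$, let $\mathrm{Lie}(n)$ be the $R$-submodule of the free Lie algebra over $R$ on $x_1,\dots,x_n$ spanned by the iterated brackets in which each generator appears exactly once. Then for every $n\ge 1$ the set $P(n)$ is finite, $\mathrm{Lie}(n)$ is a free $R$-module of rank $(n-1)!$, so that $$\frac{|P(n)|}{\operatorname{rank}_R \mathrm{Lie}(n)}=\frac{b_n}{(n-1)!},$$ and, as $n\to\infty$, $$\frac{b_n}{(n-1)!}=e^{-1}\left(1-\frac{3}{n}-\frac{5}{2n^2}+O\left(\frac{1}{n^3}\right)\right).$$ -/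

import Mathlib

/-- The multiset of symbols occurring in an iterated bracket expression. The expression `[a, b]` is
the product `a * b` of the free magma, and `FreeMagma.of x` is the single symbol `x`. -/
def bracketSymbols {α : Type*} : FreeMagma α → Multiset α
  | .of x => {x}
  | .mul a b => bracketSymbols a + bracketSymbols b

/-- The brackets contained in an expression, the outer one included; a bare symbol is not a
bracket. -/
def bracketsOf {α : Type*} : FreeMagma α → Set (FreeMagma α)
  | .of _ => ∅
  | .mul a b => insert (.mul a b) (bracketsOf a ∪ bracketsOf b)

/-- Inside each bracket `[a, b]` the smallest symbol lies in `a` and the largest one in `b`. -/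
def BracketsOrdered {α : Type*} [LinearOrder α] : FreeMagma α → Prop
  | .of _ => True
  | .mul a b =>
      (∃ i ∈ bracketSymbols a, ∀ j ∈ bracketSymbols a + bracketSymbols b, i ≤ j) ∧
      (∃ i ∈ bracketSymbols b, ∀ j ∈ bracketSymbols a + bracketSymbols b, j ≤ i) ∧
      BracketsOrdered a ∧ BracketsOrdered b

/-- The iterated brackets in `n` symbols in which every symbol occurs exactly once. The symbols
`x₁, …, xₙ` are indexed by `Fin n`. -/
def multilinearBrackets (n : ℕ) : Set (FreeMagma (Fin n)) :=
  {t | ∀ i, (bracketSymbols t).count i = 1}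

/-- The set `L(n)` of the expressions in which every symbol occurs exactly once and every bracket
has its smallest symbol on the left and its largest symbol on the right. -/
def orderedBrackets (n : ℕ) : Set (FreeMagma (Fin n)) :=
  {t | t ∈ multilinearBrackets n ∧ BracketsOrdered t}

/-- An expression is connected if the indices of its symbols form an interval of consecutive
integers. -/
def BracketConnected {n : ℕ} (t : FreeMagma (Fin n)) : Prop :=
  {i | i ∈ bracketSymbols t}.OrdConnected

/-- An expression is prime if it is a bracket and it is the only connected bracket that it
contains. -/
def BracketPrime {n : ℕ} (t : FreeMagma (Fin n)) : Prop :=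
  {s | s ∈ bracketsOf t ∧ BracketConnected s} = {t}

/-- The set `P(n)` of prime expressions in `L(n)`. -/
def primeBrackets (n : ℕ) : Set (FreeMagma (Fin n)) :=
  {t | t ∈ orderedBrackets n ∧ BracketPrime t}

/-- The number `b_n` of prime expressions in `L(n)`. -/
noncomputable def numPrimeBrackets (n : ℕ) : ℕ := (primeBrackets n).ncard

/-- The value of an iterated bracket expression in the free Lie algebra. -/
noncomputable def bracketEval (R : Type*) [CommRing R] {α : Type*} :
    FreeMagma α → FreeLieAlgebra R α
  | .of x => FreeLieAlgebra.of R x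
  | .mul a b => ⁅bracketEval R a, bracketEval R b⁆

/-- The module `Lie(n)`: the span, in the free Lie algebra on `n` generators, of the iterated
brackets in which every generator occurs exactly once. -/
noncomputable def lieOperad (R : Type*) [CommRing R] (n : ℕ) :
    Submodule R (FreeLieAlgebra R (Fin n)) :=
  Submodule.span R (bracketEval R '' multilinearBrackets n)

/-! Rank. Jacobi and skew symmetry rewrite every multilinear bracket as a combination of
right-normed brackets `[w₁, [w₂, … [wₖ, z]]]` ending in a fixed generator z. A representation by
triangular 2×2 matrices over the free associative algebra has a corner entry (a Fox derivative) that
sends such a bracket to the monomial w₁⋯wₖ, so the (n-1)! of them are linearly independent.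

Counting. There are (k-1)! ordered expressions in k symbols. Every ordered bracket arises in exactly
one way by substituting an increasing forest into a prime expression: the trees of the forest are
its maximal proper connected subexpressions. For L = ∑ (n-1)! xⁿ and B = ∑ bₙ xⁿ this reads L = x +
B(L). Since x²L' = L - x, eliminating L leaves B = B·B' + (x - B)² (`primeSeries_eq`), a quadratic
recurrence for bₙ.

Asymptotics. Put rₘ = bₘ₊₁/m!, which lies in [0, 1]. Factorials are log-convex, so the convolutions
in the recurrence are dominated by their end terms; keeping a few gives rₘ₊₁ - rₘ as an explicit
linear combination of earlier r's, with coefficients O(m⁻²), up to O(m⁻⁴)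
(`exists_primeRatio_expansion`). Hence r converges. This linearized relation is homogeneous and does
not fix the limit c; that comes from L = x + B(L), whose normalized coefficients tend termwise to
c/j!, so that c·e = 1 by dominated convergence (`primeRatio_limit`). Feeding each approximation back
into the increments then gains one power of 1/m at a time, up to the stated expansion. -/

/-! ### The multilinear part of the free Lie algebra: spanning set and independence -/

section LieOperad

variable (R : Type*) [CommRing R] {α : Type*}

/-- The right-normed bracket `[w₁, [w₂, … [wₖ, z]]]` in the free Lie algebra. -/
noncomputable def rightNormedBracket (z : α) (w : List α) : FreeLieAlgebra R α :=
  w.foldr (fun x y => ⁅FreeLieAlgebra.of R x, y⁆) (FreeLieAlgebra.of R z)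

/-- The span of the right-normed brackets ending in `z` with the other letters forming `M`. -/
noncomputable def rightNormedSpan (z : α) (M : Multiset α) : Submodule R (FreeLieAlgebra R α) :=
  Submodule.span R (rightNormedBracket R z '' {w | (w : Multiset α) = M})

/-- By Jacobi, [[a, b], y] = [a, [b, y]] - [b, [a, y]], so a bracket acts through its letters, and a
letter acts by being prepended to the word. -/
theorem bracketEval_lie_mem_rightNormedSpan (z : α) (t : FreeMagma α) (M : Multiset α)
    (y : FreeLieAlgebra R α) (hy : y ∈ rightNormedSpan R z M) :
    ⁅bracketEval R t, y⁆ ∈ rightNormedSpan R z (bracketSymbols t + M) := by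
  induction t generalizing M y with
  | ih1 x =>
    rw [rightNormedSpan] at hy
    induction hy using Submodule.span_induction with
    | mem y hy =>
      obtain ⟨w, hw, rfl⟩ := hy
      refine Submodule.subset_span ⟨x :: w, ?_, rfl⟩
      simp only [Set.mem_ofPred_eq] at hw ⊢
      rw [← hw]; rfl
    | zero => rw [lie_zero]; exact Submodule.zero_mem _
    | add a b _ _ ha hb => rw [lie_add]; exact Submodule.add_mem _ ha hb
    | smul c a _ ha => rw [lie_smul]; exact Submodule.smul_mem _ c ha
  | ih2 a b iha ihb =>
    change ⁅⁅bracketEval R a, bracketEval R b⁆, y⁆ ∈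
      rightNormedSpan R z (bracketSymbols a + bracketSymbols b + M)
    rw [lie_lie]
    refine Submodule.sub_mem _ ?_ ?_
    · rw [add_assoc]
      exact iha _ _ (ihb _ _ hy)
    · rw [add_comm (bracketSymbols a), add_assoc]
      exact ihb _ _ (iha _ _ hy)

/-- Skew symmetry puts the side containing z on the right; the other side then acts on a
right-normed combination. -/
theorem bracketEval_mem_rightNormedSpan (z : α) (t : FreeMagma α) (M : Multiset α)
    (h : bracketSymbols t = z ::ₘ M) : bracketEval R t ∈ rightNormedSpan R z M := by
  induction t generalizing M with
  | ih1 x =>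
    obtain ⟨rfl, rfl⟩ : x = z ∧ M = 0 := by
      have h' : ({x} : Multiset α) = z ::ₘ M := h
      rw [Multiset.singleton_eq_cons_iff] at h'
      exact h'
    exact Submodule.subset_span ⟨[], rfl, rfl⟩
  | ih2 a b iha ihb =>
    change bracketSymbols a + bracketSymbols b = z ::ₘ M at h
    change ⁅bracketEval R a, bracketEval R b⁆ ∈ _
    have hz : z ∈ bracketSymbols a + bracketSymbols b := h ▸ Multiset.mem_cons_self z M
    rcases Multiset.mem_add.1 hz with hz | hz
    · obtain ⟨N, hN⟩ := Multiset.exists_cons_of_mem hz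
      rw [← lie_skew]
      refine Submodule.neg_mem _ ?_
      rw [hN, Multiset.cons_add, Multiset.cons_inj_right, add_comm] at h
      exact h ▸ bracketEval_lie_mem_rightNormedSpan R z b N _ (iha N hN)
    · obtain ⟨N, hN⟩ := Multiset.exists_cons_of_mem hz
      rw [hN, Multiset.add_cons, Multiset.cons_inj_right] at h
      exact h ▸ bracketEval_lie_mem_rightNormedSpan R z a N _ (ihb N hN)

theorem exists_bracketEval_eq_rightNormedBracket (z : α) (w : List α) :
    ∃ t : FreeMagma α, bracketSymbols t = z ::ₘ (w : Multiset α) ∧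
      bracketEval R t = rightNormedBracket R z w := by
  induction w with
  | nil => exact ⟨.of z, rfl, rfl⟩
  | cons x w ih =>
    obtain ⟨t, h, h'⟩ := ih
    refine ⟨.mul (.of x) t, ?_, ?_⟩
    · change {x} + bracketSymbols t = _
      rw [h, ← Multiset.cons_coe, Multiset.singleton_add, Multiset.cons_swap]
    · change ⁅FreeLieAlgebra.of R x, bracketEval R t⁆ = _
      rw [h']; rfl

attribute [local instance] LieRing.ofAssociativeRing

open Classical in
/-- The representation of the free Lie algebra by upper triangular matrices over the free
associative algebra whose corner entry is the Fox derivative with respect to `z`. -/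
noncomputable def foxRepresentation (z : α) :
    FreeLieAlgebra R α →ₗ⁅R⁆ Matrix (Fin 2) (Fin 2) (FreeAlgebra R α) :=
  FreeLieAlgebra.lift R fun x => !![FreeAlgebra.ι R x, if x = z then 1 else 0; 0, 0]

/-- A letter x ≠ z has matrix diag(x, 0), and the commutator with it multiplies the corner entry by
x on the left; z itself starts the corner at 1. -/
theorem foxRepresentation_rightNormedBracket (z : α) (w : List α) (hw : z ∉ w) :
    ∃ u, foxRepresentation R z (rightNormedBracket R z w) =
      !![u, (w.map (FreeAlgebra.ι R)).prod; 0, 0] := by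
  induction w with
  | nil => exact ⟨FreeAlgebra.ι R z, by simp [foxRepresentation, rightNormedBracket]⟩
  | cons x w ih =>
    simp only [List.mem_cons, not_or] at hw
    obtain ⟨u, hu⟩ := ih hw.2
    refine ⟨FreeAlgebra.ι R x * u - u * FreeAlgebra.ι R x, ?_⟩
    change foxRepresentation R z ⁅FreeLieAlgebra.of R x, rightNormedBracket R z w⁆ = _
    rw [LieHom.map_lie, hu]
    simp only [foxRepresentation, FreeLieAlgebra.lift_of_apply, if_neg (Ne.symm hw.1),
      Ring.lie_def, List.map_cons, List.prod_cons]
    ext i j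
    fin_cases i <;> fin_cases j <;> simp

/-- The corner entry maps distinct words to distinct elements of the monomial basis of the free
associative algebra. -/
theorem linearIndependent_rightNormedBracket (z : α) (s : Set (List α)) (hs : ∀ w ∈ s, z ∉ w) :
    LinearIndependent R (fun w : s => rightNormedBracket R z w.1) := by
  let e : FreeLieAlgebra R α →ₗ[R] FreeAlgebra R α :=
    (Matrix.entryLinearMap R (FreeAlgebra R α) (0 : Fin 2) (1 : Fin 2)).comp
      (foxRepresentation R z : FreeLieAlgebra R α →ₗ[R] Matrix (Fin 2) (Fin 2) (FreeAlgebra R α))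
  have he : ∀ w : s, e (rightNormedBracket R z w.1) =
      FreeAlgebra.basisFreeMonoid R α (FreeMonoid.ofList w.1) := by
    intro w
    obtain ⟨u, hu⟩ := foxRepresentation_rightNormedBracket R z w.1 (hs w.1 w.2)
    have h1 : e (rightNormedBracket R z w.1) = (w.1.map (FreeAlgebra.ι R)).prod := by
      change foxRepresentation R z (rightNormedBracket R z w.1) 0 1 = _
      rw [hu]; rfl
    rw [h1]
    simp [FreeAlgebra.basisFreeMonoid, FreeAlgebra.equivMonoidAlgebraFreeMonoid,
      FreeMonoid.lift_apply]
  refine LinearIndependent.of_comp e ?_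
  have : (e ∘ fun w : s => rightNormedBracket R z w.1) =
      FreeAlgebra.basisFreeMonoid R α ∘ fun w : s => FreeMonoid.ofList w.1 := funext he
  rw [this]
  exact (FreeAlgebra.basisFreeMonoid R α).linearIndependent.comp _
    (fun a b h => Subtype.ext (FreeMonoid.ofList.injective h))

theorem lieOperad_eq_rightNormedSpan {n : ℕ} (z : Fin n) :
    lieOperad R n = rightNormedSpan R z (Finset.univ.erase z).val := by
  have key : ∀ t : FreeMagma (Fin n), t ∈ multilinearBrackets n ↔
      bracketSymbols t = z ::ₘ (Finset.univ.erase z).val := by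
    intro t
    have : z ::ₘ (Finset.univ.erase z).val = (Finset.univ : Finset (Fin n)).val := by
      rw [Finset.erase_val]
      exact Multiset.cons_erase (Finset.mem_univ z)
    rw [this, Multiset.ext]
    refine forall_congr' fun i => ?_
    rw [Multiset.count_eq_one_of_mem Finset.univ.nodup (Finset.mem_univ i)]
  apply le_antisymm
  · refine Submodule.span_le.2 ?_
    rintro _ ⟨t, ht, rfl⟩
    exact bracketEval_mem_rightNormedSpan R z t _ ((key t).1 ht)
  · refine Submodule.span_le.2 ?_
    rintro _ ⟨w, hw, rfl⟩
    obtain ⟨t, ht, ht'⟩ := exists_bracketEval_eq_rightNormedBracket R z w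
    refine Submodule.subset_span ⟨t, (key t).2 ?_, ht'⟩
    rw [ht]
    exact congrArg _ hw

theorem free_and_finrank_lieOperad [Nontrivial R] {n : ℕ} (hn : 1 ≤ n) :
    Module.Free R (lieOperad R n) ∧ Module.finrank R (lieOperad R n) = (n - 1).factorial := by
  classical
  let z : Fin n := ⟨0, hn⟩
  let l : List (Fin n) := (Finset.univ.erase z).toList
  let s : Set (List (Fin n)) := {w | (w : Multiset (Fin n)) = (Finset.univ.erase z).val}
  have hs : s = (l.permutations.toFinset : Set (List (Fin n))) := by
    ext w
    simp only [s, l, Set.mem_ofPred_eq, List.coe_toFinset, List.mem_permutations]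
    rw [← Multiset.coe_eq_coe, Finset.coe_toList]
  have hli : LinearIndependent R (fun w : s => rightNormedBracket R z w.1) := by
    refine linearIndependent_rightNormedBracket R z s fun w hw hz => ?_
    have h1 : z ∈ (w : Multiset (Fin n)) := hz
    rw [show (w : Multiset (Fin n)) = _ from hw] at h1
    exact Finset.notMem_erase z _ (Finset.mem_def.2 h1)
  have hspan : lieOperad R n =
      Submodule.span R (Set.range fun w : s => rightNormedBracket R z w.1) := by
    rw [lieOperad_eq_rightNormedSpan R z, rightNormedSpan, Set.image_eq_range]
  rw [hspan]
  have b := Module.Basis.span hli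
  refine ⟨Module.Free.of_basis b, ?_⟩
  rw [Module.finrank_eq_nat_card_basis b, Nat.card_coe_set_eq, hs, Set.ncard_coe_finset,
    List.toFinset_card_of_nodup, List.length_permutations]
  · simp [l]
  · exact List.nodup_permutations _ (Finset.nodup_toList _)

end LieOperad

/-! ### Ordered expressions and their number -/

section Trees

variable {α β : Type*}

@[simp] theorem bracketSymbols_of (x : α) : bracketSymbols (FreeMagma.of x) = {x} := rfl

@[simp] theorem bracketSymbols_mul (a b : FreeMagma α) :
    bracketSymbols (a * b) = bracketSymbols a + bracketSymbols b := rfl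

@[simp] theorem bracketsOf_of (x : α) : bracketsOf (FreeMagma.of x) = ∅ := rfl

theorem bracketsOrdered_of [LinearOrder α] (x : α) : BracketsOrdered (FreeMagma.of x) := trivial

theorem bracketsOrdered_mul [LinearOrder α] (a b : FreeMagma α) :
    BracketsOrdered (a * b) ↔
      (∃ i ∈ bracketSymbols a, ∀ j ∈ bracketSymbols a + bracketSymbols b, i ≤ j) ∧
      (∃ i ∈ bracketSymbols b, ∀ j ∈ bracketSymbols a + bracketSymbols b, j ≤ i) ∧
      BracketsOrdered a ∧ BracketsOrdered b := Iff.rfl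

theorem exists_mem_bracketSymbols (t : FreeMagma α) : ∃ i, i ∈ bracketSymbols t := by
  induction t with
  | ih1 x => exact ⟨x, by simp⟩
  | ih2 a b iha _ =>
    obtain ⟨i, hi⟩ := iha
    exact ⟨i, by simp [hi]⟩

theorem bracketSymbols_ne_zero (t : FreeMagma α) : bracketSymbols t ≠ 0 := by
  obtain ⟨i, hi⟩ := exists_mem_bracketSymbols t
  rintro h
  simp [h] at hi

/-- The ordered expressions whose symbols are the elements of `S`, each occurring once. -/
def orderedBracketsOn [LinearOrder α] (S : Finset α) : Set (FreeMagma α) :=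
  {t | bracketSymbols t = S.val ∧ BracketsOrdered t}

theorem multilinear_iff {n : ℕ} (t : FreeMagma (Fin n)) :
    t ∈ multilinearBrackets n ↔ bracketSymbols t = (Finset.univ : Finset (Fin n)).val := by
  rw [Multiset.ext]
  refine forall_congr' fun i => ?_
  rw [Multiset.count_eq_one_of_mem Finset.univ.nodup (Finset.mem_univ i)]

theorem orderedBrackets_eq (n : ℕ) :
    orderedBrackets n = orderedBracketsOn (Finset.univ : Finset (Fin n)) := by
  ext t
  exact and_congr_left fun _ => multilinear_iff t

theorem orderedBracketsOn_singleton [LinearOrder α] (x : α) :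
    orderedBracketsOn ({x} : Finset α) = {FreeMagma.of x} := by
  ext t
  constructor
  · rintro ⟨h, -⟩
    cases t with
    | of y =>
      have : y = x := by simpa using h
      rw [this]; rfl
    | mul a b =>
      have h' : (bracketSymbols a).card + (bracketSymbols b).card = 1 := by
        rw [← Multiset.card_add]
        exact congrArg Multiset.card h
      have ha := Multiset.card_pos.2 (bracketSymbols_ne_zero a)
      have hb := Multiset.card_pos.2 (bracketSymbols_ne_zero b)
      omega
  · rintro rfl
    exact ⟨rfl, trivial⟩

/-- The splittings of a symbol set into a part with the minimum and a part with the maximum. -/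
theorem orderedBracketsOn_eq_iUnion [LinearOrder α] (S : Finset α) (m M : α) (hm : m ∈ S)
    (hM : M ∈ S) (hle : ∀ i ∈ S, m ≤ i ∧ i ≤ M) (hlt : m < M) :
    orderedBracketsOn S = ⋃ A ∈ ((S.erase m).erase M).powerset,
      (fun p : FreeMagma α × FreeMagma α => p.1 * p.2) ''
        (orderedBracketsOn (insert m A) ×ˢ orderedBracketsOn (S \ insert m A)) := by
  ext t
  simp only [Set.mem_iUnion, Set.mem_image, Set.mem_prod, Prod.exists, Finset.mem_powerset]
  constructor
  · rintro ⟨h, ho⟩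
    cases t with
    | of x =>
      have h' : ({x} : Multiset α) = S.val := h
      have h1 : m ∈ ({x} : Multiset α) := h' ▸ hm
      have h2 : M ∈ ({x} : Multiset α) := h' ▸ hM
      rw [Multiset.mem_singleton] at h1 h2
      exact absurd (h1.trans h2.symm) hlt.ne
    | mul a b =>
      have hab : bracketSymbols a + bracketSymbols b = S.val := h
      obtain ⟨⟨i, hi, hi'⟩, ⟨k, hk, hk'⟩, hoa, hob⟩ := ho
      rw [hab] at hi' hk'
      have hnd : (bracketSymbols a + bracketSymbols b).Nodup := hab ▸ S.nodup
      rw [Multiset.nodup_add] at hnd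
      have hmem : ∀ x, x ∈ S ↔ x ∈ bracketSymbols a ∨ x ∈ bracketSymbols b := by
        intro x
        rw [← Multiset.mem_add, hab]; rfl
      have him : i = m := le_antisymm (hi' m hm) (hle i ((hmem i).2 (Or.inl hi))).1
      have hkM : k = M := le_antisymm (hle k ((hmem k).2 (Or.inr hk))).2 (hk' M hM)
      subst him hkM
      have hdis : ∀ x, x ∈ bracketSymbols a → x ∉ bracketSymbols b :=
        fun x hx hx' => Multiset.disjoint_left.1 hnd.2.2 hx hx'
      have hA : insert i ((⟨bracketSymbols a, hnd.1⟩ : Finset α).erase i) =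
          ⟨bracketSymbols a, hnd.1⟩ := Finset.insert_erase hi
      have hB : S \ (⟨bracketSymbols a, hnd.1⟩ : Finset α) = ⟨bracketSymbols b, hnd.2.1⟩ := by
        ext x
        simp only [Finset.mem_sdiff, Finset.mem_mk, hmem]
        have := hdis x
        tauto
      refine ⟨(⟨bracketSymbols a, hnd.1⟩ : Finset α).erase i, ?_, a, b, ⟨?_, ?_⟩, rfl⟩
      · intro x hx
        simp only [Finset.mem_erase, Finset.mem_mk] at hx ⊢
        refine ⟨?_, hx.1, (hmem x).2 (Or.inl hx.2)⟩
        rintro rfl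
        exact hdis _ hx.2 hk
      · rw [hA]; exact ⟨rfl, hoa⟩
      · rw [hA, hB]; exact ⟨rfl, hob⟩
  · rintro ⟨A, hA, a, b, ⟨⟨ha, hoa⟩, ⟨hb, hob⟩⟩, rfl⟩
    have hsub : insert m A ⊆ S := by
      intro x hx
      rcases Finset.mem_insert.1 hx with rfl | hx
      · exact hm
      · exact Finset.mem_of_mem_erase (Finset.mem_of_mem_erase (hA hx))
    have hsum : bracketSymbols a + bracketSymbols b = S.val := by
      rw [ha, hb, Finset.sdiff_val]
      exact add_tsub_cancel_of_le (Finset.val_le_iff.2 hsub)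
    refine ⟨hsum, ⟨m, ?_, ?_⟩, ⟨M, ?_, ?_⟩, hoa, hob⟩
    · rw [ha]; exact Finset.mem_insert_self m A
    · rw [hsum]; exact fun j hj => (hle j hj).1
    · rw [hb]
      refine Finset.mem_sdiff.2 ⟨hM, fun h => ?_⟩
      rcases Finset.mem_insert.1 h with h | h
      · exact hlt.ne' h
      · exact Finset.notMem_erase _ _ (hA h)
    · rw [hsum]; exact fun j hj => (hle j hj).2

/-- Each of the `T.card + 1` possible cardinalities contributes exactly `T.card !`. -/
theorem sum_powerset_factorial (T : Finset α) :
    ∑ A ∈ T.powerset, A.card.factorial * (T.card - A.card).factorial = (T.card + 1).factorial := by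
  rw [Finset.sum_powerset_apply_card (fun k => k.factorial * (T.card - k).factorial),
    Finset.sum_congr rfl (g := fun _ => T.card.factorial)]
  · simp [Nat.factorial_succ]
  · intro k hk
    rw [smul_eq_mul, ← mul_assoc]
    exact Nat.choose_mul_factorial_mul_factorial (Nat.lt_succ_iff.1 (Finset.mem_range.1 hk))

/-- There are `(k - 1)!` ordered expressions in `k` given symbols. -/
theorem finite_and_ncard_orderedBracketsOn [LinearOrder α] (S : Finset α) (hS : S.Nonempty) :
    (orderedBracketsOn S).Finite ∧ (orderedBracketsOn S).ncard = (S.card - 1).factorial := by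
  classical
  induction S using Finset.strongInduction with
  | H S ih =>
  rcases Nat.lt_or_ge 1 S.card with hc | hc
  · have hlt : S.min' hS < S.max' hS := Finset.min'_lt_max'_of_card S hc
    set m := S.min' hS
    set M := S.max' hS
    have hm : m ∈ S := S.min'_mem hS
    have hM : M ∈ S := S.max'_mem hS
    rw [orderedBracketsOn_eq_iUnion S m M hm hM
      (fun i hi => ⟨S.min'_le i hi, S.le_max' i hi⟩) hlt]
    -- The minimum is forced to the left and the maximum to the right, so a splitting is a free
    -- choice of `A ⊆ T`, with `A.card + 1` symbols on the left and `T.card - A.card + 1` on the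
    -- right.
    set T := (S.erase m).erase M with hT
    have hTc : T.card + 2 = S.card := by
      have h1 := Finset.card_erase_of_mem hm
      have h2 := Finset.card_erase_of_mem (Finset.mem_erase.2 ⟨hlt.ne', hM⟩)
      rw [hT]
      omega
    have hinsert : ∀ A ∈ T.powerset, m ∉ A ∧ insert m A ⊆ S ∧ M ∉ insert m A := by
      intro A hA
      rw [Finset.mem_powerset] at hA
      refine ⟨fun h => ?_, ?_, fun h => ?_⟩
      · exact Finset.notMem_erase _ _ (Finset.mem_of_mem_erase (hA h))
      · intro x hx
        rcases Finset.mem_insert.1 hx with rfl | hx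
        · exact hm
        · exact Finset.mem_of_mem_erase (Finset.mem_of_mem_erase (hA hx))
      · rcases Finset.mem_insert.1 h with h | h
        · exact hlt.ne' h
        · exact Finset.notMem_erase _ _ (hA h)
    have hL : ∀ A ∈ T.powerset, (orderedBracketsOn (insert m A)).Finite ∧
        (orderedBracketsOn (insert m A)).ncard = A.card.factorial := by
      intro A hA
      obtain ⟨h1, h2, h3⟩ := hinsert A hA
      have := ih (insert m A) (Finset.ssubset_iff_of_subset h2 |>.2 ⟨M, hM, h3⟩)
        (Finset.insert_nonempty _ _)
      rwa [Finset.card_insert_of_notMem h1, Nat.add_sub_cancel] at this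
    have hR : ∀ A ∈ T.powerset, (orderedBracketsOn (S \ insert m A)).Finite ∧
        (orderedBracketsOn (S \ insert m A)).ncard = (T.card - A.card).factorial := by
      intro A hA
      obtain ⟨h1, h2, h3⟩ := hinsert A hA
      have := ih (S \ insert m A)
        (Finset.ssubset_iff_of_subset Finset.sdiff_subset |>.2 ⟨m, hm, by simp⟩)
        ⟨M, Finset.mem_sdiff.2 ⟨hM, h3⟩⟩
      rw [Finset.card_sdiff_of_subset h2, Finset.card_insert_of_notMem h1] at this
      rwa [show S.card - (A.card + 1) - 1 = T.card - A.card by omega] at this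
    have hinj : Function.Injective (fun p : FreeMagma α × FreeMagma α => p.1 * p.2) := by
      rintro ⟨a, b⟩ ⟨c, d⟩ h
      injection h with h1 h2
      exact Prod.ext h1 h2
    have hfin : ∀ A ∈ T.powerset, ((fun p : FreeMagma α × FreeMagma α => p.1 * p.2) ''
        (orderedBracketsOn (insert m A) ×ˢ orderedBracketsOn (S \ insert m A))).Finite :=
      fun A hA => ((hL A hA).1.prod (hR A hA).1).image _
    refine ⟨(Finset.finite_toSet _).biUnion hfin, ?_⟩
    have hcard := Set.Finite.ncard_biUnion (Finset.finite_toSet T.powerset) hfin ?_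
    · refine hcard.trans ?_
      rw [finsum_mem_coe_finset, show S.card - 1 = T.card + 1 by omega, ← sum_powerset_factorial T]
      refine Finset.sum_congr rfl fun A hA => ?_
      rw [Set.ncard_image_of_injective _ hinj, Set.ncard_prod, (hL A hA).2, (hR A hA).2]
    · intro A hA A' hA' hne
      refine Set.disjoint_left.2 ?_
      rintro _ ⟨⟨a, b⟩, ⟨⟨ha, -⟩, -⟩, rfl⟩ ⟨⟨a', b'⟩, ⟨⟨ha', -⟩, -⟩, heq⟩
      obtain ⟨rfl, rfl⟩ := Prod.ext_iff.1 (hinj heq)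
      have h1 : insert m A' = insert m A := Finset.val_injective (ha'.symm.trans ha)
      refine hne ?_
      rw [← Finset.erase_insert (hinsert A hA).1, ← Finset.erase_insert (hinsert A' hA').1, h1]
  · have hc1 : S.card = 1 := le_antisymm hc hS.card_pos
    obtain ⟨x, rfl⟩ := Finset.card_eq_one.1 hc1
    rw [orderedBracketsOn_singleton]
    exact ⟨Set.finite_singleton _, by simp⟩

end Trees

/-! ### Substitution, subexpressions and connectedness -/

section Substitution

variable {α β : Type*}

theorem bracketSymbols_lift (f : α → FreeMagma β) (p : FreeMagma α) :
    bracketSymbols (FreeMagma.lift f p) = (bracketSymbols p).bind fun i => bracketSymbols (f i) := by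
  induction p with
  | ih1 x => simp
  | ih2 a b iha ihb => simp [iha, ihb]

theorem mem_bracketSymbols_lift {f : α → FreeMagma β} {p : FreeMagma α} {y : β} :
    y ∈ bracketSymbols (FreeMagma.lift f p) ↔ ∃ i ∈ bracketSymbols p, y ∈ bracketSymbols (f i) := by
  rw [bracketSymbols_lift, Multiset.mem_bind]

theorem lift_congr {f g : α → FreeMagma β} {p : FreeMagma α}
    (h : ∀ i ∈ bracketSymbols p, f i = g i) : FreeMagma.lift f p = FreeMagma.lift g p := by
  induction p with
  | ih1 x => simpa using h
  | ih2 a b iha ihb =>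
    rw [map_mul, map_mul, iha fun i hi => h i (by simp [hi]), ihb fun i hi => h i (by simp [hi])]

theorem lift_lift {γ : Type*} (f : β → FreeMagma γ) (g : α → FreeMagma β) (p : FreeMagma α) :
    FreeMagma.lift f (FreeMagma.lift g p) = FreeMagma.lift (fun i => FreeMagma.lift f (g i)) p := by
  induction p with
  | ih1 x => simp
  | ih2 a b iha ihb => simp [iha, ihb]

/-- The subexpressions of a bracket expression, single symbols included. -/
def subexpressions : FreeMagma α → Set (FreeMagma α)
  | .of x => {.of x}
  | .mul a b => insert (.mul a b) (subexpressions a ∪ subexpressions b)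

theorem mem_subexpressions_of {s : FreeMagma α} {x : α} :
    s ∈ subexpressions (FreeMagma.of x) ↔ s = FreeMagma.of x := Iff.rfl

theorem mem_subexpressions_mul {s a b : FreeMagma α} :
    s ∈ subexpressions (a * b) ↔ s = a * b ∨ s ∈ subexpressions a ∨ s ∈ subexpressions b := Iff.rfl

theorem self_mem_subexpressions (t : FreeMagma α) : t ∈ subexpressions t := by
  cases t with
  | of x => rfl
  | mul a b => exact Or.inl rfl

theorem length_mul (a b : FreeMagma α) : (a * b).length = a.length + b.length := rfl

theorem eq_or_length_lt_of_mem_subexpressions {s t : FreeMagma α} (h : s ∈ subexpressions t) :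
    s = t ∨ s.length < t.length := by
  induction t with
  | ih1 x => exact Or.inl h
  | ih2 a b iha ihb =>
    have ha := a.length_pos
    have hb := b.length_pos
    rw [length_mul]
    rcases mem_subexpressions_mul.1 h with h | h | h
    · exact Or.inl h
    · rcases iha h with rfl | h' <;> right <;> omega
    · rcases ihb h with rfl | h' <;> right <;> omega

theorem length_le_of_mem_subexpressions {s t : FreeMagma α} (h : s ∈ subexpressions t) :
    s.length ≤ t.length := by
  rcases eq_or_length_lt_of_mem_subexpressions h with rfl | h
  · exact le_rfl
  · exact h.le

theorem subexpressions_antisymm {s t : FreeMagma α} (h : s ∈ subexpressions t)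
    (h' : t ∈ subexpressions s) : s = t := by
  have := length_le_of_mem_subexpressions h'
  rcases eq_or_length_lt_of_mem_subexpressions h with h | h
  · exact h
  · omega

theorem bracketSymbols_subset_of_mem_subexpressions {s t : FreeMagma α}
    (h : s ∈ subexpressions t) : bracketSymbols s ⊆ bracketSymbols t := by
  induction t with
  | ih1 x => rw [mem_subexpressions_of.1 h]; exact fun _ => id
  | ih2 a b iha ihb =>
    intro x hx
    rcases mem_subexpressions_mul.1 h with rfl | h | h
    · exact hx
    · exact Multiset.mem_add.2 (Or.inl (iha h hx))
    · exact Multiset.mem_add.2 (Or.inr (ihb h hx))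

theorem mem_subexpressions_trans {s t u : FreeMagma α} (h : s ∈ subexpressions t)
    (h' : t ∈ subexpressions u) : s ∈ subexpressions u := by
  induction u with
  | ih1 x => rwa [mem_subexpressions_of.1 h'] at h
  | ih2 a b iha ihb =>
    rcases mem_subexpressions_mul.1 h' with rfl | h' | h'
    · exact h
    · exact mem_subexpressions_mul.2 (Or.inr (Or.inl (iha h')))
    · exact mem_subexpressions_mul.2 (Or.inr (Or.inr (ihb h')))

theorem bracketsOf_subset_subexpressions (t : FreeMagma α) : bracketsOf t ⊆ subexpressions t := by
  induction t with
  | ih1 x => exact Set.empty_subset _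
  | ih2 a b iha ihb => exact Set.insert_subset_insert (Set.union_subset_union iha ihb)

theorem mem_bracketsOf_mul {s a b : FreeMagma α} :
    s ∈ bracketsOf (a * b) ↔ s = a * b ∨ s ∈ bracketsOf a ∨ s ∈ bracketsOf b := Iff.rfl

theorem BracketsOrdered.of_mem_subexpressions [LinearOrder α] {s t : FreeMagma α}
    (h : s ∈ subexpressions t) (ht : BracketsOrdered t) : BracketsOrdered s := by
  induction t with
  | ih1 x => rw [mem_subexpressions_of.1 h]; trivial
  | ih2 a b iha ihb =>
    rcases mem_subexpressions_mul.1 h with rfl | h | h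
    · exact ht
    · exact iha h ht.2.2.1
    · exact ihb h ht.2.2.2

theorem mem_subexpressions_lift_of_mem {f : α → FreeMagma β} {p : FreeMagma α} {i : α}
    (hi : i ∈ bracketSymbols p) : f i ∈ subexpressions (FreeMagma.lift f p) := by
  induction p with
  | ih1 x =>
    rw [bracketSymbols_of, Multiset.mem_singleton] at hi
    rw [hi]
    exact self_mem_subexpressions _
  | ih2 a b iha ihb =>
    rw [map_mul, mem_subexpressions_mul]
    rcases Multiset.mem_add.1 hi with hi | hi
    · exact Or.inr (Or.inl (iha hi))
    · exact Or.inr (Or.inr (ihb hi))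

theorem mem_subexpressions_lift {f : α → FreeMagma β} {p : FreeMagma α} {s : FreeMagma β}
    (hs : s ∈ subexpressions (FreeMagma.lift f p)) :
    (∃ q ∈ bracketsOf p, s = FreeMagma.lift f q) ∨
      ∃ i ∈ bracketSymbols p, s ∈ subexpressions (f i) := by
  induction p with
  | ih1 x => exact Or.inr ⟨x, by simp, hs⟩
  | ih2 a b iha ihb =>
    rw [map_mul, mem_subexpressions_mul] at hs
    rcases hs with rfl | hs | hs
    · exact Or.inl ⟨a * b, Or.inl rfl, (map_mul _ _ _).symm⟩
    · rcases iha hs with ⟨q, hq, h⟩ | ⟨i, hi, h⟩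
      · exact Or.inl ⟨q, Or.inr (Or.inl hq), h⟩
      · exact Or.inr ⟨i, Multiset.mem_add.2 (Or.inl hi), h⟩
    · rcases ihb hs with ⟨q, hq, h⟩ | ⟨i, hi, h⟩
      · exact Or.inl ⟨q, Or.inr (Or.inr hq), h⟩
      · exact Or.inr ⟨i, Multiset.mem_add.2 (Or.inr hi), h⟩

theorem mem_bracketsOf_relabel {g : α → β} {p : FreeMagma α} {s : FreeMagma β} :
    s ∈ bracketsOf (FreeMagma.lift (fun i => FreeMagma.of (g i)) p) ↔
      ∃ q ∈ bracketsOf p, s = FreeMagma.lift (fun i => FreeMagma.of (g i)) q := by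
  induction p with
  | ih1 x => simp
  | ih2 a b iha ihb =>
    rw [map_mul, mem_bracketsOf_mul, iha, ihb]
    constructor
    · rintro (rfl | ⟨q, hq, h⟩ | ⟨q, hq, h⟩)
      · exact ⟨a * b, Or.inl rfl, (map_mul _ _ _).symm⟩
      · exact ⟨q, Or.inr (Or.inl hq), h⟩
      · exact ⟨q, Or.inr (Or.inr hq), h⟩
    · rintro ⟨q, rfl | hq | hq, h⟩
      · exact Or.inl (h.trans (map_mul _ _ _))
      · exact Or.inr (Or.inl ⟨q, hq, h⟩)
      · exact Or.inr (Or.inr ⟨q, hq, h⟩)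

theorem bracketSymbols_relabel (g : α → β) (p : FreeMagma α) :
    bracketSymbols (FreeMagma.lift (fun i => FreeMagma.of (g i)) p) =
      (bracketSymbols p).map g := by
  rw [bracketSymbols_lift, ← Multiset.bind_singleton]; rfl

theorem exists_relabel_eq {g : α → β} {t : FreeMagma β}
    (h : ∀ x ∈ bracketSymbols t, x ∈ Set.range g) :
    ∃ p : FreeMagma α, FreeMagma.lift (fun i => FreeMagma.of (g i)) p = t := by
  induction t with
  | ih1 x =>
    obtain ⟨i, rfl⟩ := h x (by simp)
    exact ⟨FreeMagma.of i, rfl⟩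
  | ih2 a b iha ihb =>
    obtain ⟨p, rfl⟩ := iha fun x hx => h x (by simp [hx])
    obtain ⟨q, rfl⟩ := ihb fun x hx => h x (by simp [hx])
    exact ⟨p * q, map_mul _ _ _⟩

/-- On `s`, larger indices are substituted by expressions with larger symbols. -/
def BlockMonoOn [LinearOrder α] [LinearOrder β] (f : α → FreeMagma β) (s : Set α) : Prop :=
  ∀ i ∈ s, ∀ j ∈ s, i < j → ∀ x ∈ bracketSymbols (f i), ∀ y ∈ bracketSymbols (f j), x < y

section Order

variable [LinearOrder α] [LinearOrder β] {f : α → FreeMagma β} {s : Set α}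

theorem BlockMonoOn.le_of_le (hf : BlockMonoOn f s) {i j : α} (hi : i ∈ s) (hj : j ∈ s) {x y : β}
    (hx : x ∈ bracketSymbols (f i)) (hy : y ∈ bracketSymbols (f j)) (h : x ≤ y) : i ≤ j := by
  by_contra! hlt
  exact absurd (hf j hj i hi hlt y hy x hx) (not_lt.2 h)

theorem BlockMonoOn.eq_of_mem (hf : BlockMonoOn f s) {i j : α} (hi : i ∈ s) (hj : j ∈ s) {x : β}
    (hx : x ∈ bracketSymbols (f i)) (hy : x ∈ bracketSymbols (f j)) : i = j :=
  le_antisymm (hf.le_of_le hi hj hx hy le_rfl) (hf.le_of_le hj hi hy hx le_rfl)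

theorem exists_min_bracketSymbols (t : FreeMagma α) :
    ∃ i ∈ bracketSymbols t, ∀ j ∈ bracketSymbols t, i ≤ j := by
  obtain ⟨i, hi, h⟩ := (bracketSymbols t).toFinset.exists_min_image id
    (by simpa using bracketSymbols_ne_zero t)
  exact ⟨i, by simpa using hi, fun j hj => h j (by simpa using hj)⟩

theorem exists_max_bracketSymbols (t : FreeMagma α) :
    ∃ i ∈ bracketSymbols t, ∀ j ∈ bracketSymbols t, j ≤ i := by
  obtain ⟨i, hi, h⟩ := (bracketSymbols t).toFinset.exists_max_image id
    (by simpa using bracketSymbols_ne_zero t)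
  exact ⟨i, by simpa using hi, fun j hj => h j (by simpa using hj)⟩

/-- Blocks are ordered like their indices, so the extreme symbols of a composite lie in the blocks
of the extreme indices. -/
theorem bracketsOrdered_lift_iff {p : FreeMagma α}
    (hf : BlockMonoOn f {i | i ∈ bracketSymbols p}) :
    BracketsOrdered (FreeMagma.lift f p) ↔
      BracketsOrdered p ∧ ∀ i ∈ bracketSymbols p, BracketsOrdered (f i) := by
  induction p with
  | ih1 x => simp [bracketsOrdered_of]
  | ih2 a b iha ihb =>
    have hl : ∀ i ∈ bracketSymbols a, i ∈ bracketSymbols (a * b) := fun i hi => by simp [hi]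
    have hr : ∀ i ∈ bracketSymbols b, i ∈ bracketSymbols (a * b) := fun i hi => by simp [hi]
    have key : ∀ y, y ∈ bracketSymbols (FreeMagma.lift f a) + bracketSymbols (FreeMagma.lift f b) ↔
        ∃ i ∈ bracketSymbols (a * b), y ∈ bracketSymbols (f i) := by
      intro y
      rw [← mem_bracketSymbols_lift, map_mul]; rfl
    rw [map_mul, bracketsOrdered_mul, bracketsOrdered_mul,
      iha fun i hi j hj => hf i (hl i hi) j (hl j hj),
      ihb fun i hi j hj => hf i (hr i hi) j (hr j hj)]
    have hmin : (∃ x ∈ bracketSymbols (FreeMagma.lift f a), ∀ y ∈ bracketSymbols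
        (FreeMagma.lift f a) + bracketSymbols (FreeMagma.lift f b), x ≤ y) ↔
        ∃ i ∈ bracketSymbols a, ∀ j ∈ bracketSymbols a + bracketSymbols b, i ≤ j := by
      constructor
      · rintro ⟨x, hx, h⟩
        obtain ⟨i, hi, hx⟩ := mem_bracketSymbols_lift.1 hx
        refine ⟨i, hi, fun j hj => ?_⟩
        obtain ⟨y, hy⟩ := exists_mem_bracketSymbols (f j)
        exact hf.le_of_le (hl i hi) hj hx hy (h y ((key y).2 ⟨j, hj, hy⟩))
      · rintro ⟨i, hi, h⟩
        obtain ⟨x, hx, hx'⟩ := exists_min_bracketSymbols (f i)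
        refine ⟨x, mem_bracketSymbols_lift.2 ⟨i, hi, hx⟩, fun y hy => ?_⟩
        obtain ⟨j, hj, hy⟩ := (key y).1 hy
        rcases (h j hj).eq_or_lt with rfl | hij
        · exact hx' y hy
        · exact (hf i (hl i hi) j hj hij x hx y hy).le
    have hmax : (∃ x ∈ bracketSymbols (FreeMagma.lift f b), ∀ y ∈ bracketSymbols
        (FreeMagma.lift f a) + bracketSymbols (FreeMagma.lift f b), y ≤ x) ↔
        ∃ i ∈ bracketSymbols b, ∀ j ∈ bracketSymbols a + bracketSymbols b, j ≤ i := by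
      constructor
      · rintro ⟨x, hx, h⟩
        obtain ⟨i, hi, hx⟩ := mem_bracketSymbols_lift.1 hx
        refine ⟨i, hi, fun j hj => ?_⟩
        obtain ⟨y, hy⟩ := exists_mem_bracketSymbols (f j)
        exact hf.le_of_le hj (hr i hi) hy hx (h y ((key y).2 ⟨j, hj, hy⟩))
      · rintro ⟨i, hi, h⟩
        obtain ⟨x, hx, hx'⟩ := exists_max_bracketSymbols (f i)
        refine ⟨x, mem_bracketSymbols_lift.2 ⟨i, hi, hx⟩, fun y hy => ?_⟩
        obtain ⟨j, hj, hy⟩ := (key y).1 hy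
        rcases (h j hj).eq_or_lt with rfl | hij
        · exact hx' y hy
        · exact (hf j hj i (hr i hi) hij y hy x hx).le
    rw [hmin, hmax]
    constructor
    · rintro ⟨h1, h2, ⟨h3, h4⟩, h5, h6⟩
      exact ⟨⟨h1, h2, h3, h5⟩, fun i hi => (Multiset.mem_add.1 hi).elim (h4 i) (h6 i)⟩
    · rintro ⟨⟨h1, h2, h3, h5⟩, h⟩
      exact ⟨h1, h2, ⟨h3, fun i hi => h i (hl i hi)⟩, h5, fun i hi => h i (hr i hi)⟩

/-- Blocks of distinct indices are disjoint, so a shared symbol determines the index. A leaf cannot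
match a bracket: `f x` would then be a proper subexpression of itself, against its length. -/
theorem lift_injOn_of_blockMonoOn (hf : BlockMonoOn f s) {p p' : FreeMagma α}
    (hp : ∀ i ∈ bracketSymbols p, i ∈ s) (hp' : ∀ i ∈ bracketSymbols p', i ∈ s)
    (h : FreeMagma.lift f p = FreeMagma.lift f p') : p = p' := by
  have aux : ∀ (x : α) (a b : FreeMagma α), x ∈ s → (∀ i ∈ bracketSymbols (a * b), i ∈ s) →
      f x ≠ FreeMagma.lift f (a * b) := by
    intro x a b hx hab heq
    obtain ⟨i, hi⟩ := exists_mem_bracketSymbols a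
    obtain ⟨y, hy⟩ := exists_mem_bracketSymbols (f i)
    have hi' : i ∈ bracketSymbols (a * b) := by simp [hi]
    have hy' : y ∈ bracketSymbols (f x) := by
      rw [heq]; exact mem_bracketSymbols_lift.2 ⟨i, hi', hy⟩
    obtain rfl := hf.eq_of_mem hx (hab i hi') hy' hy
    have h1 := length_le_of_mem_subexpressions (mem_subexpressions_lift_of_mem (f := f) hi)
    rw [heq, map_mul, length_mul] at h1
    have := (FreeMagma.lift f b).length_pos
    omega
  induction p generalizing p' with
  | ih1 x =>
    cases p' with
    | of y =>
      obtain ⟨z, hz⟩ := exists_mem_bracketSymbols (f x)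
      have h' : f x = f y := h
      rw [hf.eq_of_mem (hp x (by simp)) (hp' y (by simp)) hz (h' ▸ hz)]
    | mul a b => exact absurd h (aux x a b (hp x (by simp)) hp')
  | ih2 a b iha ihb =>
    cases p' with
    | of y => exact absurd h.symm (aux y a b (hp' y (by simp)) hp)
    | mul c d =>
      have h' : FreeMagma.lift f a * FreeMagma.lift f b =
        FreeMagma.lift f c * FreeMagma.lift f d := h
      injection h' with h1 h2
      rw [iha (fun i hi => hp i (Multiset.mem_add.2 (Or.inl hi)))
          (fun i hi => hp' i (Multiset.mem_add.2 (Or.inl hi))) h1,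
        ihb (fun i hi => hp i (Multiset.mem_add.2 (Or.inr hi)))
          (fun i hi => hp' i (Multiset.mem_add.2 (Or.inr hi))) h2]
      rfl

/-- An expression is connected in `S` if its symbols form an interval of `S`. -/
def ConnectedIn (S : Finset α) (t : FreeMagma α) : Prop :=
  ∀ x ∈ bracketSymbols t, ∀ z ∈ bracketSymbols t, ∀ y ∈ S, x ≤ y → y ≤ z → y ∈ bracketSymbols t

theorem connectedIn_of (S : Finset α) (x : α) : ConnectedIn S (FreeMagma.of x) := by
  intro a ha b hb y _ h1 h2
  simp only [bracketSymbols_of, Multiset.mem_singleton] at *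
  subst ha hb
  exact le_antisymm h2 h1

/-- Collapsing each block to its index is monotone, so intervals of blocks correspond to intervals
of indices. -/
theorem connectedIn_lift_iff {S : Finset α} {T : Finset β} (hf : BlockMonoOn f S)
    (hS : ∀ y, y ∈ T ↔ ∃ i ∈ S, y ∈ bracketSymbols (f i)) {q : FreeMagma α}
    (hq : ∀ i ∈ bracketSymbols q, i ∈ S) :
    ConnectedIn T (FreeMagma.lift f q) ↔ ConnectedIn S q := by
  constructor
  · intro h i hi l hl j hj hij hjl
    obtain ⟨x, hx⟩ := exists_mem_bracketSymbols (f i)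
    obtain ⟨y, hy⟩ := exists_mem_bracketSymbols (f j)
    obtain ⟨z, hz⟩ := exists_mem_bracketSymbols (f l)
    rcases hij.eq_or_lt with rfl | hij
    · exact hi
    rcases hjl.eq_or_lt with rfl | hjl
    · exact hl
    obtain ⟨i', hi', hy'⟩ := mem_bracketSymbols_lift.1 (h x (mem_bracketSymbols_lift.2 ⟨i, hi, hx⟩)
      z (mem_bracketSymbols_lift.2 ⟨l, hl, hz⟩) y ((hS y).2 ⟨j, hj, hy⟩)
      (hf i (hq i hi) j hj hij x hx y hy).le (hf j hj l (hq l hl) hjl y hy z hz).le)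
    rwa [hf.eq_of_mem hj (hq i' hi') hy hy']
  · intro h x hx z hz y hy hxy hyz
    obtain ⟨i, hi, hx⟩ := mem_bracketSymbols_lift.1 hx
    obtain ⟨l, hl, hz⟩ := mem_bracketSymbols_lift.1 hz
    obtain ⟨j, hj, hy⟩ := (hS y).1 hy
    exact mem_bracketSymbols_lift.2 ⟨j, h i hi l hl j hj (hf.le_of_le (hq i hi) hj hx hy hxy)
      (hf.le_of_le hj (hq l hl) hy hz hyz), hy⟩

/-- The prime expressions whose symbols are the elements of `S`. -/
def primeBracketsOn (S : Finset α) : Set (FreeMagma α) :=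
  {t | t ∈ orderedBracketsOn S ∧ t ∈ bracketsOf t ∧ ∀ s ∈ bracketsOf t, ConnectedIn S s → s = t}

theorem primeBrackets_eq (n : ℕ) :
    primeBrackets n = primeBracketsOn (Finset.univ : Finset (Fin n)) := by
  ext t
  rw [primeBrackets, orderedBrackets_eq]
  refine and_congr_right fun ht => ?_
  have hc : ∀ s : FreeMagma (Fin n), BracketConnected s ↔ ConnectedIn Finset.univ s := by
    intro s
    refine ⟨fun h x hx z hz y _ h1 h2 => h.out hx hz ⟨h1, h2⟩, fun h => ⟨?_⟩⟩
    intro x hx z hz y hy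
    exact h x hx z hz y (Finset.mem_univ y) hy.1 hy.2
  have ht' : ConnectedIn Finset.univ t := by
    intro x _ z _ y hy _ _
    rw [ht.1]; exact hy
  simp only [BracketPrime, hc, Set.eq_singleton_iff_unique_mem, Set.mem_ofPred_eq, ht', and_true,
    and_imp]

theorem relabel_mem_primeBracketsOn_iff {g : α → β} (hg : StrictMono g) {S : Finset α}
    {T : Finset β} (hT : T.val = S.val.map g) {t : FreeMagma α} :
    FreeMagma.lift (fun i => FreeMagma.of (g i)) t ∈ primeBracketsOn T ↔ t ∈ primeBracketsOn S := by
  have hmono : ∀ s : Set α, BlockMonoOn (fun i => FreeMagma.of (g i)) s := by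
    intro s i _ j _ hij x hx y hy
    simp only [bracketSymbols_of, Multiset.mem_singleton] at hx hy
    rw [hx, hy]; exact hg hij
  have hinj : ∀ s s' : FreeMagma α, FreeMagma.lift (fun i => FreeMagma.of (g i)) s =
      FreeMagma.lift (fun i => FreeMagma.of (g i)) s' → s = s' := fun s s' =>
    lift_injOn_of_blockMonoOn (hmono Set.univ) (fun _ _ => trivial) (fun _ _ => trivial)
  have hS : ∀ y, y ∈ T ↔ ∃ i ∈ S, y ∈ bracketSymbols ((fun i => FreeMagma.of (g i)) i) := by
    intro y
    rw [← Finset.mem_val, hT]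
    simp [eq_comm]
  have hord : FreeMagma.lift (fun i => FreeMagma.of (g i)) t ∈ orderedBracketsOn T ↔
      t ∈ orderedBracketsOn S := by
    refine and_congr ?_ ?_
    · rw [bracketSymbols_relabel, hT]
      exact (Multiset.map_injective hg.injective).eq_iff
    · rw [bracketsOrdered_lift_iff (hmono _)]
      exact and_iff_left fun _ _ => trivial
  refine (and_congr_right fun h => ?_).trans (and_congr_left' hord)
  have ht := (hord.1 h).1
  have hsub : ∀ q ∈ bracketsOf t, ∀ i ∈ bracketSymbols q, i ∈ S := by
    intro q hq i hi
    have := bracketSymbols_subset_of_mem_subexpressions (bracketsOf_subset_subexpressions t hq) hi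
    rwa [ht] at this
  refine and_congr ?_ ?_
  · rw [mem_bracketsOf_relabel]
    constructor
    · rintro ⟨q, hq, h⟩
      obtain rfl := hinj _ _ h
      exact hq
    · exact fun h => ⟨t, h, rfl⟩
  · constructor
    · intro h q hq hc
      refine hinj _ _ (h _ (mem_bracketsOf_relabel.2 ⟨q, hq, rfl⟩) ?_)
      exact (connectedIn_lift_iff (hmono _) hS (hsub q hq)).2 hc
    · intro h s hs hc
      obtain ⟨q, hq, rfl⟩ := mem_bracketsOf_relabel.1 hs
      rw [h q hq ((connectedIn_lift_iff (hmono _) hS (hsub q hq)).1 hc)]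

end Order

/-- Passing to symbols in ℕ puts all arities into the single type `FreeMagma ℕ`, where expressions
of different arities can be composed. -/
theorem primeBracketsOn_range (k : ℕ) :
    primeBracketsOn (Finset.range k) =
      FreeMagma.lift (fun i : Fin k => FreeMagma.of (i : ℕ)) '' primeBrackets k := by
  have hT : (Finset.range k).val = (Finset.univ : Finset (Fin k)).val.map Fin.val := by
    rw [← Nat.Iio_eq_range, ← Fin.map_valEmbedding_univ]; rfl
  rw [primeBrackets_eq]
  ext t
  constructor
  · intro ht
    obtain ⟨p, rfl⟩ := exists_relabel_eq (g := (Fin.val : Fin k → ℕ)) (t := t) (by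
      intro x hx
      rw [ht.1.1] at hx
      exact ⟨⟨x, Finset.mem_range.1 hx⟩, rfl⟩)
    exact ⟨p, (relabel_mem_primeBracketsOn_iff Fin.val_strictMono hT).1 ht, rfl⟩
  · rintro ⟨p, hp, rfl⟩
    exact (relabel_mem_primeBracketsOn_iff Fin.val_strictMono hT).2 hp

theorem ncard_primeBracketsOn_range (k : ℕ) :
    (primeBracketsOn (Finset.range k)).ncard = numPrimeBrackets k := by
  rw [primeBracketsOn_range, numPrimeBrackets]
  refine Set.ncard_image_of_injective _ fun p p' h => ?_
  refine lift_injOn_of_blockMonoOn (s := Set.univ) ?_ (fun _ _ => trivial) (fun _ _ => trivial) h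
  intro i _ j _ hij x hx y hy
  simp only [bracketSymbols_of, Multiset.mem_singleton] at hx hy
  rw [hx, hy]; exact hij

end Substitution

/-! ### Counting increasing forests by powers of the generating function -/

section Forests

/-- All symbols of the first expression are smaller than those of the second one. -/
def SymbolsLT {α : Type*} [LinearOrder α] (u v : FreeMagma α) : Prop :=
  ∀ x ∈ bracketSymbols u, ∀ y ∈ bracketSymbols v, x < y

theorem not_symbolsLT_self {α : Type*} [LinearOrder α] (u : FreeMagma α) : ¬SymbolsLT u u := by
  obtain ⟨x, hx⟩ := exists_mem_bracketSymbols u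
  exact fun h => lt_irrefl x (h x hx x hx)

/-- The increasing lists of `k` ordered expressions which use each symbol in `S` exactly once. -/
def orderedForestsOn {α : Type*} [LinearOrder α] (S : Finset α) (k : ℕ) :
    Set (List (FreeMagma α)) :=
  {F | F.length = k ∧ F.Pairwise SymbolsLT ∧ (∀ t ∈ F, BracketsOrdered t) ∧
    (F.map bracketSymbols).sum = S.val}

theorem mem_sum_map_bracketSymbols {α : Type*} {F : List (FreeMagma α)} {y : α} :
    y ∈ (F.map bracketSymbols).sum ↔ ∃ t ∈ F, y ∈ bracketSymbols t := by
  induction F with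
  | nil => simp
  | cons u F ih => simp [ih]

theorem mem_of_mem_forest {α : Type*} [LinearOrder α] {S : Finset α} {k : ℕ}
    {F : List (FreeMagma α)} (hF : F ∈ orderedForestsOn S k) {y : α} :
    y ∈ S ↔ ∃ t ∈ F, y ∈ bracketSymbols t := by
  rw [← Finset.mem_val, ← hF.2.2.2, mem_sum_map_bracketSymbols]

theorem orderedForestsOn_zero {α : Type*} [LinearOrder α] (S : Finset α) :
    orderedForestsOn S 0 = if S = ∅ then {[]} else ∅ := by
  ext F
  constructor
  · rintro ⟨h, -, -, h'⟩
    obtain rfl := List.length_eq_zero_iff.1 h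
    rw [if_pos (Finset.val_eq_zero.1 h'.symm)]; rfl
  · split_ifs with h
    · rintro rfl
      subst h
      exact ⟨rfl, List.Pairwise.nil, by simp, rfl⟩
    · exact False.elim

/-- The first tree of an increasing forest on an interval occupies an initial interval. The left end
is arbitrary because the remaining trees start at `a + p.1`. -/
theorem orderedForestsOn_Ico_succ (a n k : ℕ) :
    orderedForestsOn (Finset.Ico a (a + n)) (k + 1) = ⋃ p ∈ Finset.HasAntidiagonal.antidiagonal n,
      (fun q : FreeMagma ℕ × List (FreeMagma ℕ) => q.1 :: q.2) ''
        (orderedBracketsOn (Finset.Ico a (a + p.1)) ×ˢ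
          orderedForestsOn (Finset.Ico (a + p.1) (a + p.1 + p.2)) k) := by
  ext F
  simp only [Set.mem_iUnion, Set.mem_image, Set.mem_prod, Prod.exists,
    Finset.HasAntidiagonal.mem_antidiagonal]
  constructor
  · rintro ⟨hl, hp, ho, hs⟩
    cases F with
    | nil => simp at hl
    | cons t F =>
      rw [List.pairwise_cons] at hp
      rw [List.map_cons, List.sum_cons] at hs
      have hnd : (bracketSymbols t + (F.map bracketSymbols).sum).Nodup := hs ▸ Finset.nodup _
      rw [Multiset.nodup_add] at hnd
      have hmemF : ∀ y, y ∈ (F.map bracketSymbols).sum ↔ ∃ u ∈ F, y ∈ bracketSymbols u := by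
        exact fun y => mem_sum_map_bracketSymbols
      have hmem : ∀ y, (a ≤ y ∧ y < a + n) ↔
          y ∈ bracketSymbols t ∨ y ∈ (F.map bracketSymbols).sum := by
        intro y
        rw [← Finset.mem_Ico, ← Finset.mem_val, ← hs, Multiset.mem_add]
      -- All later trees lie above the largest symbol M of the first one, so every symbol up to M
      -- belongs to the first tree.
      obtain ⟨M, hM, hM'⟩ := exists_max_bracketSymbols t
      have hMb := (hmem M).2 (Or.inl hM)
      obtain ⟨m, hm⟩ : ∃ m, M + 1 = a + m := ⟨M + 1 - a, by omega⟩
      obtain ⟨m', rfl⟩ : ∃ m', n = m + m' := ⟨n - m, by omega⟩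
      have ht : ∀ y, y ∈ bracketSymbols t ↔ a ≤ y ∧ y < a + m := by
        intro y
        constructor
        · intro hy
          have := hM' y hy
          have := (hmem y).2 (Or.inl hy)
          omega
        · intro hy
          rcases (hmem y).1 ⟨hy.1, by omega⟩ with h | h
          · exact h
          · obtain ⟨u, hu, hyu⟩ := (hmemF y).1 h
            have := hp.1 u hu M hM y hyu
            omega
      have hF : ∀ y, y ∈ (F.map bracketSymbols).sum ↔ a + m ≤ y ∧ y < a + m + m' := by
        intro y
        have h1 : y ∈ bracketSymbols t → y ∉ (F.map bracketSymbols).sum :=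
          fun h h' => Multiset.disjoint_left.1 hnd.2.2 h h'
        have h2 := hmem y
        have h3 := ht y
        by_cases hy : y ∈ bracketSymbols t
        · simp only [h1 hy, false_iff]
          have := h3.1 hy
          omega
        · simp only [hy, false_or, false_iff] at h2 h3
          rw [← h2]
          omega
      refine ⟨m, m', rfl, t, F, ⟨⟨?_, ho t (by simp)⟩, ?_, hp.2, fun u hu => ho u (by simp [hu]),
        ?_⟩, rfl⟩
      · refine (Multiset.Nodup.ext hnd.1 (Finset.nodup _)).2 fun y => ?_
        rw [ht, Finset.mem_val, Finset.mem_Ico]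
      · simpa using hl
      · refine (Multiset.Nodup.ext hnd.2.1 (Finset.nodup _)).2 fun y => ?_
        rw [hF, Finset.mem_val, Finset.mem_Ico]
  · rintro ⟨m, m', rfl, t, F, ⟨⟨ht, hto⟩, hF⟩, rfl⟩
    refine ⟨by simp [hF.1], List.pairwise_cons.2 ⟨?_, hF.2.1⟩, ?_, ?_⟩
    · intro u hu x hx y hy
      have h1 := (mem_of_mem_forest hF).2 ⟨u, hu, hy⟩
      rw [ht, Finset.mem_val, Finset.mem_Ico] at hx
      rw [Finset.mem_Ico] at h1
      omega
    · intro u hu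
      rcases List.mem_cons.1 hu with rfl | hu
      · exact hto
      · exact hF.2.2.1 u hu
    · rw [List.map_cons, List.sum_cons, ht, hF.2.2.2]
      have hd : Disjoint (Finset.Ico a (a + m)) (Finset.Ico (a + m) (a + m + m')) :=
        Finset.Ico_disjoint_Ico_consecutive _ _ _
      rw [← Finset.disjUnion_val _ _ hd, Finset.disjUnion_eq_union,
        Finset.Ico_union_Ico_eq_Ico (by omega) (by omega), add_assoc]

/-- The number of ordered expressions in `n` given symbols. -/
def numOrderedBrackets (n : ℕ) : ℕ := if n = 0 then 0 else (n - 1).factorial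

theorem finite_and_ncard_orderedBracketsOn_Ico (a n : ℕ) :
    (orderedBracketsOn (Finset.Ico a (a + n))).Finite ∧
      (orderedBracketsOn (Finset.Ico a (a + n))).ncard = numOrderedBrackets n := by
  rw [numOrderedBrackets]
  -- Truncated subtraction would give `(0 - 1)! = 1`, whereas no expression has an empty symbol set.
  split_ifs with h
  · subst h
    have : orderedBracketsOn (Finset.Ico a (a + 0)) = ∅ := by
      refine Set.eq_empty_of_forall_notMem fun t ht => bracketSymbols_ne_zero t ?_
      rw [ht.1]; simp
    rw [this]
    exact ⟨Set.finite_empty, by simp⟩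
  · have := finite_and_ncard_orderedBracketsOn (Finset.Ico a (a + n))
      (Finset.nonempty_Ico.2 (by omega))
    rwa [Nat.card_Ico, Nat.add_sub_cancel_left] at this

/-- The generating function of the numbers of ordered expressions. -/
noncomputable def orderedSeries (K : Type*) [Semiring K] : PowerSeries K :=
  PowerSeries.mk fun n => (numOrderedBrackets n : K)

/-- Peeling off the first tree is one Cauchy product with the series of ordered expressions. -/
theorem finite_and_ncard_orderedForestsOn_Ico (k a n : ℕ) :
    (orderedForestsOn (Finset.Ico a (a + n)) k).Finite ∧
      (orderedForestsOn (Finset.Ico a (a + n)) k).ncard =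
        PowerSeries.coeff n (orderedSeries ℕ ^ k) := by
  induction k generalizing a n with
  | zero =>
    rw [orderedForestsOn_zero, pow_zero, PowerSeries.coeff_one]
    have : Finset.Ico a (a + n) = ∅ ↔ n = 0 := by simp
    simp only [this]
    split_ifs <;> simp
  | succ k ih =>
    have hfin : ∀ p ∈ Finset.HasAntidiagonal.antidiagonal n,
        ((fun q : FreeMagma ℕ × List (FreeMagma ℕ) => q.1 :: q.2) ''
        (orderedBracketsOn (Finset.Ico a (a + p.1)) ×ˢ
          orderedForestsOn (Finset.Ico (a + p.1) (a + p.1 + p.2)) k)).Finite := fun p _ =>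
      ((finite_and_ncard_orderedBracketsOn_Ico a p.1).1.prod (ih (a + p.1) p.2).1).image _
    have hinj : Function.Injective
        (fun q : FreeMagma ℕ × List (FreeMagma ℕ) => q.1 :: q.2) := by
      rintro ⟨a, b⟩ ⟨c, d⟩ h
      injection h with h1 h2
      exact Prod.ext h1 h2
    rw [orderedForestsOn_Ico_succ]
    refine ⟨(Finset.finite_toSet _).biUnion hfin, ?_⟩
    refine (Set.Finite.ncard_biUnion (Finset.finite_toSet (Finset.HasAntidiagonal.antidiagonal n)) hfin ?_).trans ?_
    · intro p hp p' hp' hne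
      refine Set.disjoint_left.2 ?_
      rintro _ ⟨⟨t, F⟩, ⟨⟨ht, -⟩, -⟩, rfl⟩ ⟨⟨t', F'⟩, ⟨⟨ht', -⟩, -⟩, heq⟩
      obtain ⟨rfl, rfl⟩ := Prod.ext_iff.1 (hinj heq)
      have h1 := congrArg Multiset.card (ht.symm.trans ht')
      simp only [Finset.card_val, Nat.card_Ico, Nat.add_sub_cancel_left] at h1
      rw [Finset.mem_coe, Finset.HasAntidiagonal.mem_antidiagonal] at hp hp'
      exact hne (Prod.ext h1 (by omega))
    · rw [finsum_mem_coe_finset, pow_succ', PowerSeries.coeff_mul]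
      refine Finset.sum_congr rfl fun p _ => ?_
      rw [Set.ncard_image_of_injective _ hinj, Set.ncard_prod, (ih _ _).2,
        (finite_and_ncard_orderedBracketsOn_Ico _ _).2, orderedSeries, PowerSeries.coeff_mk]
      rfl

end Forests

/-! ### Unique decomposition into a prime expression and a forest -/

section Decomposition

/-- Substitution of the entries of a list of expressions for the symbols `0, 1, 2, …`. -/
def substituteList (F : List (FreeMagma ℕ)) : FreeMagma ℕ →ₙ* FreeMagma ℕ :=
  FreeMagma.lift fun i => F.getD i (FreeMagma.of 0)

theorem blockMonoOn_getD {F : List (FreeMagma ℕ)} (h : F.Pairwise SymbolsLT) :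
    BlockMonoOn (fun i => F.getD i (FreeMagma.of 0)) (Finset.range F.length) := by
  intro i hi j hj hij
  have hi' : i < F.length := Finset.mem_range.1 hi
  have hj' : j < F.length := Finset.mem_range.1 hj
  simp only [List.getD_eq_getElem _ _ hi', List.getD_eq_getElem _ _ hj']
  exact List.pairwise_iff_getElem.1 h i j hi' hj' hij

theorem map_getD_range {α : Type*} (F : List α) (d : α) :
    (List.range F.length).map (fun i => F.getD i d) = F := by
  refine List.ext_getElem (by simp) fun i h1 h2 => ?_
  rw [List.getElem_map, List.getElem_range, List.getD_eq_getElem _ _ h2]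

theorem exists_getD_iff {α : Type*} {F : List α} {d : α} {P : α → Prop} :
    (∃ i ∈ Finset.range F.length, P (F.getD i d)) ↔ ∃ t ∈ F, P t := by
  constructor
  · rintro ⟨i, hi, h⟩
    rw [List.getD_eq_getElem _ _ (Finset.mem_range.1 hi)] at h
    exact ⟨_, List.getElem_mem _, h⟩
  · rintro ⟨t, ht, h⟩
    obtain ⟨i, hi, rfl⟩ := List.getElem_of_mem ht
    refine ⟨i, Finset.mem_range.2 hi, ?_⟩
    rwa [List.getD_eq_getElem _ _ hi]

/-- The symbols of p are exactly the indices of F, so the default value in `substituteList` is never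
reached. -/
theorem substituteList_mem {S : Finset ℕ} {k : ℕ} {p : FreeMagma ℕ} {F : List (FreeMagma ℕ)}
    (hp : p ∈ orderedBracketsOn (Finset.range k)) (hF : F ∈ orderedForestsOn S k) :
    substituteList F p ∈ orderedBracketsOn S := by
  obtain ⟨rfl, hF1, hF2, hF3⟩ := hF
  have hmem : ∀ i, i ∈ bracketSymbols p ↔ i ∈ Finset.range F.length := by
    intro i; rw [hp.1]; rfl
  refine ⟨?_, (bracketsOrdered_lift_iff ?_).2 ⟨hp.2, fun i hi => ?_⟩⟩
  · rw [substituteList, bracketSymbols_lift, hp.1, ← hF3, Finset.range_val]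
    conv_rhs => rw [← map_getD_range F (FreeMagma.of 0), List.map_map]
    rw [← Multiset.sum_coe]
    rfl
  · intro i hi j hj
    exact blockMonoOn_getD hF1 i ((hmem i).1 hi) j ((hmem j).1 hj)
  · rw [List.getD_eq_getElem _ _ (Finset.mem_range.1 ((hmem i).1 hi))]
    exact hF2 _ (List.getElem_mem _)

theorem mem_range_of_mem_bracketsOf {k : ℕ} {p q : FreeMagma ℕ}
    (hp : p ∈ orderedBracketsOn (Finset.range k)) (hq : q ∈ bracketsOf p) :
    ∀ i ∈ bracketSymbols q, i ∈ Finset.range k := by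
  intro i hi
  have := bracketSymbols_subset_of_mem_subexpressions (bracketsOf_subset_subexpressions p hq) hi
  rwa [hp.1] at this

theorem forest_hS {S : Finset ℕ} {F : List (FreeMagma ℕ)}
    (hF : F ∈ orderedForestsOn S F.length) (y : ℕ) :
    y ∈ S ↔ ∃ i ∈ Finset.range F.length, y ∈ bracketSymbols (F.getD i (FreeMagma.of 0)) := by
  rw [mem_of_mem_forest hF]
  exact (exists_getD_iff (P := fun t => y ∈ bracketSymbols t)).symm

/-- The connected proper subexpressions of a composite of a prime expression with a forest lie
inside the trees of the forest. -/
theorem exists_mem_forest_of_connectedIn {S : Finset ℕ} {p s : FreeMagma ℕ}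
    {F : List (FreeMagma ℕ)} (hp : p ∈ primeBracketsOn (Finset.range F.length))
    (hF : F ∈ orderedForestsOn S F.length) (hs : s ∈ subexpressions (substituteList F p))
    (hc : ConnectedIn S s) (hne : s ≠ substituteList F p) : ∃ u ∈ F, s ∈ subexpressions u := by
  rcases mem_subexpressions_lift hs with ⟨q, hq, rfl⟩ | ⟨i, hi, h⟩
  · rw [connectedIn_lift_iff (blockMonoOn_getD hF.2.1) (forest_hS hF)
      (mem_range_of_mem_bracketsOf hp.1 hq)] at hc
    exact absurd (by rw [hp.2.2 q hq hc]; rfl) hne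
  · rw [hp.1.1] at hi
    exact exists_getD_iff.1 ⟨i, hi, h⟩

/-- Together with the preceding lemma this makes the trees of F the maximal proper connected
subexpressions of the composite, hence intrinsic to it. -/
theorem mem_forest_spec {S : Finset ℕ} {p u : FreeMagma ℕ}
    {F : List (FreeMagma ℕ)} (hp : p ∈ primeBracketsOn (Finset.range F.length))
    (hF : F ∈ orderedForestsOn S F.length) (hu : u ∈ F) :
    u ∈ subexpressions (substituteList F p) ∧ ConnectedIn S u ∧ u ≠ substituteList F p := by
  obtain ⟨i, hi, rfl⟩ := List.getElem_of_mem hu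
  rw [← List.getD_eq_getElem _ (FreeMagma.of 0) hi]
  have hi' : i ∈ bracketSymbols p := by
    rw [hp.1.1]; exact Finset.mem_range.2 hi
  refine ⟨mem_subexpressions_lift_of_mem hi', ?_, ?_⟩
  · have h1 : F.getD i (FreeMagma.of 0) =
      FreeMagma.lift (fun i => F.getD i (FreeMagma.of 0)) (FreeMagma.of i) := rfl
    rw [h1, connectedIn_lift_iff (blockMonoOn_getD hF.2.1) (forest_hS hF)]
    · exact connectedIn_of _ _
    · simpa using hi
  · intro heq
    cases p with
    | of x => exact hp.2.1
    | mul a b =>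
      have hl : (substituteList F (a * b)).length =
          (substituteList F a).length + (substituteList F b).length := by
        rw [map_mul, length_mul]
      have ha := (substituteList F a).length_pos
      have hb := (substituteList F b).length_pos
      have hle : (F.getD i (FreeMagma.of 0)).length ≤ (substituteList F a).length ∨
          (F.getD i (FreeMagma.of 0)).length ≤ (substituteList F b).length :=
        (Multiset.mem_add.1 hi').imp
          (fun h => length_le_of_mem_subexpressions (mem_subexpressions_lift_of_mem h))
          (fun h => length_le_of_mem_subexpressions (mem_subexpressions_lift_of_mem h))
      rw [FreeMagma.mul_eq] at heq
      rw [heq] at hle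
      omega

/-- A tree u of F lies in a tree v of F', which lies in a tree w of F. Trees of F have disjoint
symbols, so u = w, and then u = v. -/
theorem forest_subset_of_substituteList_eq {S : Finset ℕ} {p p' : FreeMagma ℕ}
    {F F' : List (FreeMagma ℕ)} (hp : p ∈ primeBracketsOn (Finset.range F.length))
    (hF : F ∈ orderedForestsOn S F.length) (hp' : p' ∈ primeBracketsOn (Finset.range F'.length))
    (hF' : F' ∈ orderedForestsOn S F'.length) (h : substituteList F p = substituteList F' p') :
    F ⊆ F' := by
  intro u hu
  obtain ⟨h1, h2, h3⟩ := mem_forest_spec hp hF hu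
  rw [h] at h1 h3
  obtain ⟨v, hv, huv⟩ := exists_mem_forest_of_connectedIn hp' hF' h1 h2 h3
  obtain ⟨h4, h5, h6⟩ := mem_forest_spec hp' hF' hv
  rw [← h] at h4 h6
  obtain ⟨w, hw, hvw⟩ := exists_mem_forest_of_connectedIn hp hF h4 h5 h6
  have huw : u = w := by
    by_contra hne
    obtain ⟨x, hx⟩ := exists_mem_bracketSymbols u
    have hx' : x ∈ bracketSymbols w :=
      bracketSymbols_subset_of_mem_subexpressions (mem_subexpressions_trans huv hvw) hx
    have hpw : F.Pairwise fun u w => ∀ x, x ∈ bracketSymbols u → x ∉ bracketSymbols w :=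
      hF.2.1.imp fun hlt x hx hx' => lt_irrefl x (hlt x hx x hx')
    have : Std.Symm fun u w : FreeMagma ℕ => ∀ x, x ∈ bracketSymbols u → x ∉ bracketSymbols w :=
      ⟨fun _ _ h x hx hx' => h x hx' hx⟩
    exact hpw.forall hu hw hne x hx hx'
  subst huw
  rwa [subexpressions_antisymm huv hvw]

theorem nodup_of_pairwise_symbolsLT {α : Type*} [LinearOrder α] {F : List (FreeMagma α)}
    (h : F.Pairwise SymbolsLT) : F.Nodup :=
  h.imp fun {a b} hab (heq : a = b) => not_symbolsLT_self a (by rw [← heq] at hab; exact hab)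

/-- The two forests have the same trees and increasing order fixes the list; injectivity of
substitution then recovers the prime factor. -/
theorem substituteList_inj {S : Finset ℕ} {p p' : FreeMagma ℕ}
    {F F' : List (FreeMagma ℕ)} (hp : p ∈ primeBracketsOn (Finset.range F.length))
    (hF : F ∈ orderedForestsOn S F.length) (hp' : p' ∈ primeBracketsOn (Finset.range F'.length))
    (hF' : F' ∈ orderedForestsOn S F'.length) (h : substituteList F p = substituteList F' p') :
    p = p' ∧ F = F' := by
  have hperm : F.Perm F' := by
    refine (List.perm_ext_iff_of_nodup (nodup_of_pairwise_symbolsLT hF.2.1)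
      (nodup_of_pairwise_symbolsLT hF'.2.1)).2 fun u => ⟨fun hu => ?_, fun hu => ?_⟩
    · exact forest_subset_of_substituteList_eq hp hF hp' hF' h hu
    · exact forest_subset_of_substituteList_eq hp' hF' hp hF h.symm hu
  have hFF : F = F' := by
    refine hperm.eq_of_pairwise (fun u v _ _ huv hvu => ?_) hF.2.1 hF'.2.1
    obtain ⟨x, hx⟩ := exists_mem_bracketSymbols u
    obtain ⟨y, hy⟩ := exists_mem_bracketSymbols v
    exact absurd (huv x hx y hy) (hvu y hy x hx).not_gt
  subst hFF
  refine ⟨lift_injOn_of_blockMonoOn (blockMonoOn_getD hF.2.1) (fun i hi => ?_) (fun i hi => ?_) h,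
    rfl⟩
  · rw [hp.1.1] at hi; exact hi
  · rw [hp'.1.1] at hi; exact hi

open Classical in
/-- The expression in the maximal connected subexpressions. -/
noncomputable def skeleton {α : Type*} [LinearOrder α] (S : Finset α) :
    FreeMagma α → FreeMagma (FreeMagma α)
  | .of x => .of (.of x)
  | .mul a b => if ConnectedIn S (a * b) then .of (a * b) else skeleton S a * skeleton S b

section Skeleton

variable {α : Type*} [LinearOrder α] (S : Finset α)

theorem skeleton_of (x : α) : skeleton S (FreeMagma.of x) = FreeMagma.of (FreeMagma.of x) := rfl

open Classical in
theorem skeleton_mul (a b : FreeMagma α) : skeleton S (a * b) =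
    if ConnectedIn S (a * b) then FreeMagma.of (a * b) else skeleton S a * skeleton S b := rfl

theorem lift_id_skeleton (t : FreeMagma α) : FreeMagma.lift id (skeleton S t) = t := by
  induction t with
  | ih1 x => rfl
  | ih2 a b iha ihb =>
    rw [skeleton_mul]
    split_ifs with h
    · rfl
    · rw [map_mul, iha, ihb]

theorem connectedIn_of_mem_skeleton (t : FreeMagma α) :
    ∀ u ∈ bracketSymbols (skeleton S t), ConnectedIn S u := by
  induction t with
  | ih1 x =>
    intro u hu
    rw [skeleton_of, bracketSymbols_of, Multiset.mem_singleton] at hu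
    rw [hu]; exact connectedIn_of S x
  | ih2 a b iha ihb =>
    intro u hu
    rw [skeleton_mul] at hu
    split_ifs at hu with h
    · rw [bracketSymbols_of, Multiset.mem_singleton] at hu
      rwa [hu]
    · exact (Multiset.mem_add.1 hu).elim (iha u) (ihb u)

theorem not_connectedIn_of_mem_bracketsOf_skeleton (t : FreeMagma α) :
    ∀ q ∈ bracketsOf (skeleton S t), ¬ConnectedIn S (FreeMagma.lift id q) := by
  induction t with
  | ih1 x => exact fun q hq => hq.elim
  | ih2 a b iha ihb =>
    intro q hq
    rw [skeleton_mul] at hq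
    split_ifs at hq with h
    · exact hq.elim
    · rcases mem_bracketsOf_mul.1 hq with rfl | hq | hq
      · rwa [map_mul, lift_id_skeleton, lift_id_skeleton]
      · exact iha q hq
      · exact ihb q hq

/-- Disjoint intervals of S lie entirely on one side of each other, so a single comparison decides.
-/
theorem symbolsLT_of_connectedIn {u v : FreeMagma α} (hu : ConnectedIn S u) (hv : ConnectedIn S v)
    (huS : ∀ x ∈ bracketSymbols u, x ∈ S) (hvS : ∀ x ∈ bracketSymbols v, x ∈ S)
    (hd : Disjoint (bracketSymbols u) (bracketSymbols v)) {x y : α} (hx : x ∈ bracketSymbols u)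
    (hy : y ∈ bracketSymbols v) (hxy : x ≤ y) : SymbolsLT u v := by
  intro x' hx' y' hy'
  by_contra! h
  rcases le_total y x' with h1 | h1
  · exact Multiset.disjoint_left.1 hd (hu x hx x' hx' y (hvS y hy) hxy h1) hy
  · exact Multiset.disjoint_left.1 hd hx' (hv y' hy' y hy x' (huS x' hx') h h1)

end Skeleton

theorem exists_sorted_perm {α : Type*} [LinearOrder α] {S : Finset α} {l : List (FreeMagma α)}
    (hc : ∀ u ∈ l, ConnectedIn S u) (hS : ∀ u ∈ l, ∀ x ∈ bracketSymbols u, x ∈ S)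
    (hd : l.Pairwise fun u v => Disjoint (bracketSymbols u) (bracketSymbols v)) :
    ∃ F : List (FreeMagma α), F.Perm l ∧ F.Pairwise SymbolsLT := by
  classical
  choose g hg using exists_mem_bracketSymbols (α := α)
  let r : FreeMagma α → FreeMagma α → Prop := fun u v => g u ≤ g v
  have : Std.Total r := ⟨fun u v => le_total (g u) (g v)⟩
  have : IsTrans (FreeMagma α) r := ⟨fun _ _ _ h1 h2 => le_trans h1 h2⟩
  refine ⟨l.insertionSort r, List.perm_insertionSort r l, ?_⟩
  have hd' : (l.insertionSort r).Pairwise fun u v =>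
      Disjoint (bracketSymbols u) (bracketSymbols v) :=
    ((List.perm_insertionSort r l).pairwise_iff fun h => h.symm).2 hd
  have hr := List.pairwise_insertionSort r l
  have hmem : ∀ u ∈ l.insertionSort r, u ∈ l := fun u hu => (List.mem_insertionSort r).1 hu
  refine List.Pairwise.imp_of_mem ?_ (hr.and hd')
  rintro u v hu hv ⟨h1, h2⟩
  exact symbolsLT_of_connectedIn S (hc u (hmem u hu)) (hc v (hmem v hv)) (hS u (hmem u hu))
    (hS v (hmem v hv)) h2 (hg u) (hg v) h1

theorem map_idxOf_self {α : Type*} [DecidableEq α] {F : List α} (h : F.Nodup) :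
    F.map (fun u => F.idxOf u) = List.range F.length := by
  refine List.ext_getElem (by simp) fun i h1 h2 => ?_
  simp [h.idxOf_getElem]

/-- Sort the maximal proper connected subexpressions into F, and let p be the skeleton with each
leaf replaced by its position in F. A connected proper bracket of p would give a connected
subexpression that the skeleton had failed to cut off. -/
theorem exists_substituteList_eq {S : Finset ℕ} {a b : FreeMagma ℕ}
    (ht : a * b ∈ orderedBracketsOn S) :
    ∃ F p, F ∈ orderedForestsOn S F.length ∧ p ∈ primeBracketsOn (Finset.range F.length) ∧
      substituteList F p = a * b := by
  -- The symbols of `a * b` fill S, so its own skeleton would be a single leaf; the cutting starts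
  -- one level below.
  set W := skeleton S a * skeleton S b with hW
  have hWt : FreeMagma.lift id W = a * b := by
    rw [hW, map_mul, lift_id_skeleton, lift_id_skeleton]
  have hWc : ∀ u ∈ bracketSymbols W, ConnectedIn S u := fun u hu =>
    (Multiset.mem_add.1 hu).elim (connectedIn_of_mem_skeleton S a u)
      (connectedIn_of_mem_skeleton S b u)
  have hWsub : ∀ u ∈ bracketSymbols W, u ∈ subexpressions (a * b) := by
    intro u hu
    rw [← hWt]
    exact mem_subexpressions_lift_of_mem (f := id) hu
  have hWS : ∀ u ∈ bracketSymbols W, ∀ x ∈ bracketSymbols u, x ∈ S := by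
    intro u hu x hx
    have := bracketSymbols_subset_of_mem_subexpressions (hWsub u hu) hx
    rwa [ht.1] at this
  have hbind : (bracketSymbols W).bind bracketSymbols = S.val := by
    rw [← ht.1, ← hWt, bracketSymbols_lift]; rfl
  obtain ⟨l, hl, hld⟩ := (Multiset.nodup_bind.1 (hbind ▸ S.nodup)).2
  have hlmem : ∀ u, u ∈ l ↔ u ∈ bracketSymbols W := by
    intro u; rw [hl]; rfl
  obtain ⟨F, hFl, hFp⟩ := exists_sorted_perm (S := S) (fun u hu => hWc u ((hlmem u).1 hu))
    (fun u hu => hWS u ((hlmem u).1 hu)) hld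
  have hFW : (F : Multiset (FreeMagma ℕ)) = bracketSymbols W := by
    rw [hl]; exact Multiset.coe_eq_coe.2 hFl
  have hFmem : ∀ u, u ∈ F ↔ u ∈ bracketSymbols W := by
    intro u; rw [← hFW]; rfl
  have hF : F ∈ orderedForestsOn S F.length := by
    refine ⟨rfl, hFp, fun u hu => ht.2.of_mem_subexpressions (hWsub u ((hFmem u).1 hu)), ?_⟩
    rw [← hbind, ← hFW, ← Multiset.sum_coe]
    rfl
  set p := FreeMagma.lift (fun u => FreeMagma.of (F.idxOf u)) W with hp
  have hback : ∀ q : FreeMagma (FreeMagma ℕ), bracketSymbols q ⊆ bracketSymbols W →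
      substituteList F (FreeMagma.lift (fun u => FreeMagma.of (F.idxOf u)) q) =
        FreeMagma.lift id q := by
    intro q hq
    rw [substituteList, lift_lift]
    refine lift_congr fun u hu => ?_
    have huF : F.idxOf u < F.length := List.idxOf_lt_length_iff.2 ((hFmem u).2 (hq hu))
    rw [FreeMagma.lift_of, List.getD_eq_getElem _ _ huF, List.getElem_idxOf]; rfl
  have hpt : substituteList F p = a * b := (hback W fun _ => id).trans hWt
  have hps : bracketSymbols p = (Finset.range F.length).val := by
    rw [hp, bracketSymbols_relabel, ← hFW, Multiset.map_coe,
      map_idxOf_self (nodup_of_pairwise_symbolsLT hFp)]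
    rfl
  have hpL : p ∈ orderedBracketsOn (Finset.range F.length) := by
    refine ⟨hps, ((bracketsOrdered_lift_iff (f := fun i => F.getD i (FreeMagma.of 0)) ?_).1 ?_).1⟩
    · intro i hi j hj
      simp only [hps] at hi hj
      exact blockMonoOn_getD hFp i hi j hj
    · have : BracketsOrdered (substituteList F p) := hpt ▸ ht.2
      exact this
  refine ⟨F, p, hF, ⟨hpL, ?_, ?_⟩, hpt⟩
  · rw [hp, hW, map_mul]
    exact Or.inl rfl
  · intro s hs hsc
    obtain ⟨q, hq, rfl⟩ := mem_bracketsOf_relabel.1 hs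
    have h1 := (connectedIn_lift_iff (blockMonoOn_getD hFp) (forest_hS hF)
      (mem_range_of_mem_bracketsOf hpL hs)).2 hsc
    have h2 : ConnectedIn S (substituteList F
      (FreeMagma.lift (fun u => FreeMagma.of (F.idxOf u)) q)) := h1
    rw [hback q (bracketSymbols_subset_of_mem_subexpressions
      (bracketsOf_subset_subexpressions W hq))] at h2
    rcases mem_bracketsOf_mul.1 hq with rfl | hq | hq
    · rfl
    · exact absurd h2 (not_connectedIn_of_mem_bracketsOf_skeleton S a q hq)
    · exact absurd h2 (not_connectedIn_of_mem_bracketsOf_skeleton S b q hq)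

theorem length_le_card_sum_map_bracketSymbols {α : Type*} (F : List (FreeMagma α)) :
    F.length ≤ (F.map bracketSymbols).sum.card := by
  induction F with
  | nil => simp
  | cons u F ih =>
    have := Multiset.card_pos.2 (bracketSymbols_ne_zero u)
    rw [List.length_cons, List.map_cons, List.sum_cons, Multiset.card_add]
    omega

theorem orderedBracketsOn_range_eq_iUnion {n : ℕ} (hn : 2 ≤ n) :
    orderedBracketsOn (Finset.range n) = ⋃ k ∈ Finset.range (n + 1),
      (fun q : FreeMagma ℕ × List (FreeMagma ℕ) => substituteList q.2 q.1) ''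
        (primeBracketsOn (Finset.range k) ×ˢ orderedForestsOn (Finset.range n) k) := by
  ext t
  simp only [Set.mem_iUnion, Set.mem_image, Set.mem_prod, Prod.exists]
  constructor
  · intro ht
    cases t with
    | of x =>
      have h1 := congrArg Multiset.card ht.1
      rw [bracketSymbols_of, Multiset.card_singleton, Finset.card_val, Finset.card_range] at h1
      omega
    | mul a b =>
      obtain ⟨F, p, hF, hp, h⟩ := exists_substituteList_eq ht
      refine ⟨F.length, ?_, p, F, ⟨hp, hF⟩, h⟩
      have h1 := congrArg Multiset.card hF.2.2.2
      have h2 := length_le_card_sum_map_bracketSymbols F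
      rw [Finset.card_val, Finset.card_range] at h1
      rw [Finset.mem_range]
      omega
  · rintro ⟨k, -, p, F, ⟨hp, hF⟩, rfl⟩
    exact substituteList_mem hp.1 hF

theorem finite_primeBracketsOn_range (k : ℕ) : (primeBracketsOn (Finset.range k)).Finite := by
  have := (finite_and_ncard_orderedBracketsOn_Ico 0 k).1
  rw [zero_add, ← Finset.range_eq_Ico] at this
  exact this.subset fun t ht => ht.1

/-- Every ordered expression which is a bracket is uniquely a composite of a prime one with a
forest. -/
theorem numOrderedBrackets_eq_sum {n : ℕ} (hn : 2 ≤ n) :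
    numOrderedBrackets n = ∑ k ∈ Finset.range (n + 1),
      numPrimeBrackets k * PowerSeries.coeff n (orderedSeries ℕ ^ k) := by
  have hforest : ∀ k, (orderedForestsOn (Finset.range n) k).Finite ∧
      (orderedForestsOn (Finset.range n) k).ncard =
        PowerSeries.coeff n (orderedSeries ℕ ^ k) := by
    intro k
    have := finite_and_ncard_orderedForestsOn_Ico k 0 n
    rwa [zero_add, ← Finset.range_eq_Ico] at this
  have hcard := (finite_and_ncard_orderedBracketsOn_Ico 0 n).2
  rw [zero_add, ← Finset.range_eq_Ico, orderedBracketsOn_range_eq_iUnion hn] at hcard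
  rw [← hcard]
  refine (Set.Finite.ncard_biUnion (Finset.finite_toSet (Finset.range (n + 1))) (fun k _ =>
    ((finite_primeBracketsOn_range k).prod (hforest k).1).image _) ?_).trans ?_
  · intro k _ k' _ hne
    refine Set.disjoint_left.2 ?_
    rintro _ ⟨⟨p, F⟩, ⟨hp, hF⟩, rfl⟩ ⟨⟨p', F'⟩, ⟨hp', hF'⟩, heq⟩
    obtain rfl : F.length = k := hF.1
    obtain rfl : F'.length = k' := hF'.1
    exact hne (congrArg List.length (substituteList_inj hp hF hp' hF' heq.symm).2)
  · rw [finsum_mem_coe_finset]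
    refine Finset.sum_congr rfl fun k _ => ?_
    rw [Set.InjOn.ncard_image, Set.ncard_prod, (hforest k).2, ncard_primeBracketsOn_range]
    rintro ⟨p, F⟩ ⟨hp, hF⟩ ⟨p', F'⟩ ⟨hp', hF'⟩ heq
    obtain rfl : F.length = k := hF.1
    have hl : F'.length = F.length := hF'.1
    simp only at hp' hF'
    rw [← hl] at hp' hF'
    obtain ⟨rfl, rfl⟩ := substituteList_inj hp hF hp' hF' heq
    rfl

end Decomposition

/-! ### Functional and differential equations, and the recurrence -/

section Series

open PowerSeries

theorem numPrimeBrackets_zero : numPrimeBrackets 0 = 0 := by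
  rw [← ncard_primeBracketsOn_range, Set.ncard_eq_zero (finite_primeBracketsOn_range 0)]
  refine Set.eq_empty_of_forall_notMem fun t ht => bracketSymbols_ne_zero t ?_
  rw [ht.1.1]; rfl

theorem numPrimeBrackets_one : numPrimeBrackets 1 = 0 := by
  rw [← ncard_primeBracketsOn_range, Set.ncard_eq_zero (finite_primeBracketsOn_range 1)]
  refine Set.eq_empty_of_forall_notMem fun t ht => ?_
  have h1 := ht.1
  rw [show Finset.range 1 = {0} from rfl, orderedBracketsOn_singleton] at h1
  obtain rfl : t = FreeMagma.of 0 := h1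
  exact ht.2.1

theorem numPrimeBrackets_le (n : ℕ) : numPrimeBrackets n ≤ numOrderedBrackets n := by
  have h := finite_and_ncard_orderedBracketsOn_Ico 0 n
  rw [zero_add, ← Finset.range_eq_Ico] at h
  rw [← ncard_primeBracketsOn_range, ← h.2]
  exact Set.ncard_le_ncard (fun t ht => ht.1) h.1

/-- The generating function of the numbers of prime expressions. -/
noncomputable def primeSeries : PowerSeries ℝ := PowerSeries.mk fun n => (numPrimeBrackets n : ℝ)

theorem coeff_primeSeries (n : ℕ) : coeff n primeSeries = numPrimeBrackets n := coeff_mk _ _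

theorem coeff_orderedSeries {K : Type*} [Semiring K] (n : ℕ) :
    coeff n (orderedSeries K) = numOrderedBrackets n := coeff_mk _ _

theorem coeff_orderedSeries_pow_cast (n k : ℕ) :
    coeff n (orderedSeries ℝ ^ k) = (coeff n (orderedSeries ℕ ^ k) : ℕ) := by
  have : orderedSeries ℝ = map (Nat.castRingHom ℝ) (orderedSeries ℕ) := by
    ext m
    rw [coeff_map, coeff_orderedSeries, coeff_orderedSeries]; simp
  rw [this, ← map_pow, coeff_map]; simp

theorem constantCoeff_orderedSeries : constantCoeff (orderedSeries ℝ) = 0 := by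
  rw [← coeff_zero_eq_constantCoeff_apply, coeff_orderedSeries]; simp [numOrderedBrackets]

theorem hasSubst_orderedSeries : HasSubst (orderedSeries ℝ) :=
  HasSubst.of_constantCoeff_zero' constantCoeff_orderedSeries

theorem coeff_orderedSeries_pow_eq_zero {n k : ℕ} (h : n < k) :
    coeff n (orderedSeries ℝ ^ k) = 0 := by
  have h1 : X ∣ orderedSeries ℝ := X_dvd_iff.2 constantCoeff_orderedSeries
  exact X_pow_dvd_iff.1 (pow_dvd_pow_of_dvd h1 k) n h

/-- From degree 2 on, this is the unique decomposition read coefficientwise; X accounts for the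
single symbol. -/
theorem orderedSeries_eq_X_add_subst :
    orderedSeries ℝ = X + primeSeries.subst (orderedSeries ℝ) := by
  ext n
  rw [map_add, coeff_subst' hasSubst_orderedSeries,
    finsum_eq_sum_of_support_subset (s := Finset.range (n + 1))]
  · rcases Nat.lt_or_ge n 2 with hn | hn
    · interval_cases n
      · simp [coeff_orderedSeries, coeff_primeSeries, numPrimeBrackets_zero, numOrderedBrackets]
      · simp [coeff_orderedSeries, coeff_primeSeries, numPrimeBrackets_zero, numPrimeBrackets_one,
          numOrderedBrackets, Finset.sum_range_succ, coeff_one_X]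
    · rw [coeff_X, if_neg (by omega), zero_add, coeff_orderedSeries, numOrderedBrackets_eq_sum hn]
      push_cast
      refine Finset.sum_congr rfl fun k _ => ?_
      rw [coeff_orderedSeries_pow_cast, coeff_primeSeries, smul_eq_mul]
  · intro k hk
    by_contra h
    refine hk ?_
    simp only [Finset.coe_range, Set.mem_Iio, not_lt] at h
    simp only [coeff_orderedSeries_pow_eq_zero (show n < k by omega), smul_zero]

/-- In coefficients, this is (n + 1) · n! = (n + 1)!. -/
theorem X_sq_mul_derivative_orderedSeries :
    X ^ 2 * derivative ℝ (orderedSeries ℝ) = orderedSeries ℝ - X := by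
  ext n
  rcases n with _ | _ | n
  · simp [constantCoeff_orderedSeries]
  · rw [show (0 + 1) = 1 from rfl, coeff_X_pow_mul', if_neg (by omega), map_sub,
      coeff_orderedSeries, coeff_one_X]
    simp [numOrderedBrackets]
  · rw [show n + 1 + 1 = n + 2 from rfl, coeff_X_pow_mul, coeff_derivative, map_sub, coeff_X, if_neg (by omega), sub_zero,
      coeff_orderedSeries, coeff_orderedSeries]
    simp [numOrderedBrackets, Nat.factorial_succ]
    ring

/-- Differentiating L = x + B(L) gives L'·(1 - B'(L)) = 1. Multiply x²L' = L - x by 1 - B'(L) and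
put x = L - B(L): the claim holds after substituting L. -/
theorem primeSeries_eq :
    primeSeries = primeSeries * derivative ℝ primeSeries + (X - primeSeries) ^ 2 := by
  set L := orderedSeries ℝ with hL
  have hs : HasSubst L := hasSubst_orderedSeries
  have h1 : L = X + primeSeries.subst L := orderedSeries_eq_X_add_subst
  have h2 : X ^ 2 * derivative ℝ L = L - X := X_sq_mul_derivative_orderedSeries
  have h3 : derivative ℝ L = 1 + (derivative ℝ primeSeries).subst L * derivative ℝ L := by
    conv_lhs => rw [h1]
    rw [map_add, derivative_subst hs, derivative_X]
  have hB : primeSeries.subst L = L - X := by rw [eq_sub_iff_add_eq, add_comm]; exact h1.symm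
  set D := primeSeries * derivative ℝ primeSeries + (X - primeSeries) ^ 2 - primeSeries with hD
  have hDL : D.subst L = 0 := by
    rw [hD, subst_sub hs, subst_add hs, subst_mul hs, subst_pow hs, subst_sub hs, subst_X hs, hB]
    linear_combination (1 - (derivative ℝ primeSeries).subst L) * h2 - X ^ 2 * h3
  -- L has a compositional inverse, so the substituted identity can be undone.
  have hu : IsUnit (coeff 1 L) := by
    rw [hL, coeff_orderedSeries]; simp [numOrderedBrackets]
  have hD0 : D = 0 := by
    have h4 := subst_comp_subst_apply hs (HasSubst.substInvOfIsUnit L hu) D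
    rw [subst_substInvOfIsUnit_right L constantCoeff_orderedSeries hu, hDL] at h4
    rw [X_subst, ← coe_substAlgHom (HasSubst.substInvOfIsUnit L hu), map_zero] at h4
    exact h4.symm
  rw [hD, sub_eq_zero] at hD0
  exact hD0.symm

/-- The coefficients of the square of `primeSeries`. -/
noncomputable def primeConvolution (n : ℕ) : ℝ := coeff n (primeSeries * primeSeries)

/-- Since B·B' = (B²)'/2, both quadratic terms are expressed by coefficients of B². -/
theorem numPrimeBrackets_recurrence (n : ℕ) :
    (numPrimeBrackets (n + 3) : ℝ) = (n + 4) / 2 * primeConvolution (n + 4)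
      - 2 * numPrimeBrackets (n + 2) + primeConvolution (n + 3) := by
  have h := congrArg (coeff (n + 3)) primeSeries_eq
  have h2 : derivative ℝ (primeSeries * primeSeries) =
      2 * (primeSeries * derivative ℝ primeSeries) := by
    rw [Derivation.leibniz]; simp only [smul_eq_mul]; ring
  have h3 := congrArg (coeff (n + 3)) h2
  rw [coeff_derivative, show (2 : PowerSeries ℝ) = C 2 from rfl, coeff_C_mul] at h3
  have h4 : (X - primeSeries) ^ 2 = X ^ 2 - C 2 * (X * primeSeries) + primeSeries * primeSeries := by
    rw [show (C 2 : PowerSeries ℝ) = 2 from rfl]; ring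
  rw [h4, map_add, map_add, map_sub, coeff_C_mul, coeff_succ_X_mul, coeff_X_pow,
    if_neg (by omega), coeff_primeSeries, coeff_primeSeries] at h
  rw [primeConvolution, primeConvolution]
  push_cast at h3
  linarith

/-- Coefficient form of x²(Lᵏ⁺¹)' = (k + 1) Lᵏ (L - x). -/
theorem coeff_orderedSeries_pow_recurrence (n k : ℕ) :
    (k + 1) * coeff (n + 1) (orderedSeries ℝ ^ (k + 1)) =
      (k + 1) * coeff n (orderedSeries ℝ ^ k) + n * coeff n (orderedSeries ℝ ^ (k + 1)) := by
  set L := orderedSeries ℝ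
  have h : X * (X * derivative ℝ (L ^ (k + 1))) =
      C ((k : ℝ) + 1) * L ^ (k + 1) - C ((k : ℝ) + 1) * (X * L ^ k) := by
    rw [Derivation.leibniz_pow, nsmul_eq_mul, smul_eq_mul, Nat.add_sub_cancel]
    have h2 : X ^ 2 * derivative ℝ L = L - X := X_sq_mul_derivative_orderedSeries
    have h3 : (C ((k : ℝ) + 1) : PowerSeries ℝ) = ((k + 1 : ℕ) : PowerSeries ℝ) := by
      push_cast; simp
    rw [h3]
    linear_combination ((k + 1 : ℕ) : PowerSeries ℝ) * L ^ k * h2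
  have h1 := congrArg (coeff (n + 1)) h
  rw [coeff_succ_X_mul, map_sub, coeff_C_mul, coeff_C_mul, coeff_succ_X_mul] at h1
  have h2 : coeff n (X * derivative ℝ (L ^ (k + 1))) = n * coeff n (L ^ (k + 1)) := by
    cases n with
    | zero => simp
    | succ n => rw [coeff_succ_X_mul, coeff_derivative]; push_cast; ring
  linarith

end Series

/-! ### Identification of the limit as 1/e -/

section Constant

open PowerSeries Filter Topology

/-- The proportion of prime expressions among the ordered ones in `n + 1` symbols. -/
noncomputable def primeRatio (n : ℕ) : ℝ := numPrimeBrackets (n + 1) / n.factorial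

theorem numPrimeBrackets_succ (n : ℕ) :
    (numPrimeBrackets (n + 1) : ℝ) = n.factorial * primeRatio n := by
  rw [primeRatio, mul_div_cancel₀ _ (by positivity)]

theorem primeRatio_nonneg (n : ℕ) : 0 ≤ primeRatio n := by
  rw [primeRatio]; positivity

theorem primeRatio_le_one (n : ℕ) : primeRatio n ≤ 1 := by
  rw [primeRatio, div_le_one (by positivity)]
  exact_mod_cast numPrimeBrackets_le (n + 1)

theorem primeRatio_zero : primeRatio 0 = 0 := by simp [primeRatio, numPrimeBrackets_one]

/-- The normalized number of forests with `k + 1` trees and `k + 1 + j` symbols. -/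
noncomputable def forestRatio (k j : ℕ) : ℝ :=
  k.factorial * coeff (k + 1 + j) (orderedSeries ℝ ^ (k + 1)) / (k + j).factorial

theorem forestRatio_zero_right (k : ℕ) : forestRatio k 0 = 1 := by
  have h : ∀ k : ℕ, coeff k (orderedSeries ℝ ^ k) = 1 := by
    intro k
    induction k with
    | zero => simp
    | succ k ih =>
      have := coeff_orderedSeries_pow_recurrence k k
      rw [ih, coeff_orderedSeries_pow_eq_zero (Nat.lt_succ_self k), mul_zero, add_zero] at this
      exact mul_left_cancel₀ (by positivity) this
  rw [forestRatio, add_zero, add_zero, h, mul_one, div_self (by positivity)]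

theorem forestRatio_zero_left (j : ℕ) : forestRatio 0 j = 1 := by
  rw [forestRatio, zero_add, pow_one, coeff_orderedSeries, numOrderedBrackets, if_neg (by omega)]
  simp only [zero_add, Nat.add_sub_cancel_left, Nat.factorial_zero, Nat.cast_one, one_mul]
  exact div_self (by positivity)

theorem forestRatio_succ_succ (k j : ℕ) :
    forestRatio (k + 1) (j + 1) = (k + 1) / (k + j + 2) * forestRatio k (j + 1) +
      forestRatio (k + 1) j / (k + 2) := by
  have h := coeff_orderedSeries_pow_recurrence (k + j + 2) (k + 1)
  simp only [forestRatio]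
  rw [show k + 1 + 1 + (j + 1) = k + j + 2 + 1 by ring, show k + 1 + (j + 1) = k + j + 2 by ring,
    show k + 1 + 1 + j = k + j + 2 by ring, show k + (j + 1) = k + j + 1 by ring,
    show k + 1 + j = k + j + 1 by ring]
  set A := coeff (k + j + 2 + 1) (orderedSeries ℝ ^ (k + 1 + 1))
  set B := coeff (k + j + 2) (orderedSeries ℝ ^ (k + 1))
  set D := coeff (k + j + 2) (orderedSeries ℝ ^ (k + 1 + 1))
  push_cast at h
  have hA : A = B + (k + j + 2) / (k + 2) * D := by
    field_simp
    linear_combination h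
  rw [hA, show k + j + 2 = (k + j + 1) + 1 by ring, Nat.factorial_succ (k + j + 1),
    Nat.factorial_succ k]
  push_cast
  have h1 : ((k + j + 1).factorial : ℝ) ≠ 0 := by positivity
  have h2 : (k : ℝ) + j + 1 + 1 ≠ 0 := by positivity
  have h3 : (k : ℝ) + j + 2 ≠ 0 := by positivity
  field_simp
  ring

theorem forestRatio_nonneg (k j : ℕ) : 0 ≤ forestRatio k j := by
  rw [forestRatio, coeff_orderedSeries_pow_cast]
  positivity

theorem forestRatio_one_le (j : ℕ) : forestRatio 1 j ≤ 4 / (j + 1) := by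
  induction j with
  | zero => rw [forestRatio_zero_right]; norm_num
  | succ j ih =>
    have h := forestRatio_succ_succ 0 j
    rw [forestRatio_zero_left] at h
    simp only [zero_add, CharP.cast_eq_zero, mul_one] at h
    rw [h]
    rcases Nat.eq_zero_or_pos j with rfl | hj
    · rw [forestRatio_zero_right]; norm_num
    · have hj' : (1 : ℝ) ≤ j := by exact_mod_cast hj
      calc 1 / ((j : ℝ) + 2) + forestRatio 1 j / 2 ≤ 1 / ((j : ℝ) + 2) + 4 / (j + 1) / 2 := by
            gcongr
        _ ≤ 4 / (((j + 1 : ℕ) : ℝ) + 1) := by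
            push_cast
            rw [div_div, div_add_div _ _ (by positivity) (by positivity),
              div_le_div_iff₀ (by positivity) (by positivity)]
            nlinarith

theorem forestRatio_one_right (k : ℕ) : forestRatio k 1 = 1 := by
  induction k with
  | zero => exact forestRatio_zero_left 1
  | succ k ih =>
    have h := forestRatio_succ_succ k 0
    rw [zero_add, ih, forestRatio_zero_right] at h
    rw [h]
    push_cast
    field_simp
    ring

/-- A summable majorant in j, uniform in k. The first two rows are excluded: one is constantly 1,
and for the other only a bound of order 1/j is at hand, which starts the induction on k. -/
theorem forestRatio_le (k j : ℕ) : forestRatio (k + 2) j ≤ 24 / ((j + 1) * (j + 2)) := by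
  induction j generalizing k with
  | zero => rw [forestRatio_zero_right]; norm_num
  | succ j ihj =>
    rcases Nat.eq_zero_or_pos j with rfl | hj
    · rw [zero_add, forestRatio_one_right]; norm_num
    have hj' : (1 : ℝ) ≤ j := by exact_mod_cast hj
    induction k with
    | zero =>
      have h := forestRatio_succ_succ 1 j
      have h1 := forestRatio_one_le (j + 1)
      have h2 := ihj 0
      push_cast at h h1 ⊢
      -- This fixes the constant: with C for 24 the inequality at j = 1 reads 8 + 2C/3 ≤ C.
      calc forestRatio (0 + 2) (j + 1) ≤ (1 + 1) / (1 + j + 2) * (4 / (j + 1 + 1)) +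
            24 / ((j + 1) * (j + 2)) / (1 + 2) := by
            rw [show 0 + 2 = 1 + 1 from rfl, h]
            gcongr
        _ ≤ 24 / ((j + 1 + 1) * (j + 1 + 2)) := by
            rw [div_mul_div_comm, div_div, div_add_div _ _ (by positivity) (by positivity),
              div_le_div_iff₀ (by positivity) (by positivity)]
            have : 0 ≤ ((j : ℝ) - 1) * ((j + 2) * (j + 2) * (j + 3)) :=
              mul_nonneg (by linarith) (by positivity)
            nlinarith
    | succ k ihk =>
      have h := forestRatio_succ_succ (k + 2) j
      have h1 := ihj (k + 1)
      have hk : (0 : ℝ) ≤ k := Nat.cast_nonneg k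
      rw [show k + 2 + 1 = k + 1 + 2 by ring] at h
      rw [h]
      push_cast at ihk ⊢
      -- The general estimate just fails at j = 1, where the exact value `forestRatio k 1 = 1` is
      -- used instead.
      rcases Nat.eq_or_lt_of_le hj with rfl | hj2
      · rw [forestRatio_one_right]
        calc _ ≤ ((k : ℝ) + 2 + 1) / (k + 2 + 1 + 2) * 2 + 1 / (k + 2 + 2) := by
              push_cast
              gcongr
              exact ihk.trans (by norm_num)
          _ ≤ _ := by
              push_cast
              rw [div_mul_eq_mul_div, div_add_div _ _ (by positivity) (by positivity),
                div_le_div_iff₀ (by positivity) (by positivity)]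
              nlinarith
      · have hj2' : (2 : ℝ) ≤ j := by exact_mod_cast hj2
        calc _ ≤ ((k : ℝ) + 2 + 1) / (k + 2 + j + 2) * (24 / ((j + 1 + 1) * (j + 1 + 2))) +
              24 / ((j + 1) * (j + 2)) / (k + 2 + 2) := by gcongr
          _ = 24 / ((j + 1 + 1) * (j + 1 + 2)) * (((k : ℝ) + 3) / (k + j + 4) +
                (j + 3) / ((j + 1) * (k + 4))) := by
              field_simp
              ring
          _ ≤ 24 / ((j + 1 + 1) * (j + 1 + 2)) * 1 := by
              gcongr
              rw [div_add_div _ _ (by positivity) (by positivity), div_le_one (by positivity)]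
              have h3 : 0 ≤ (k : ℝ) * ((j + 2) * (j - 1)) :=
                mul_nonneg hk (mul_nonneg (by positivity) (by linarith))
              nlinarith
          _ = _ := mul_one _

/-- For e = x - l/J one has (k + 1 + J) eₖ₊₁ = (k + 1) eₖ + (zₖ - l). As J ≥ 1, (k + 1)|eₖ| grows by
at most |zₖ - l| per step, so |eₖ| is controlled by a Cesàro mean of a null sequence. -/
theorem tendsto_of_averaging_recurrence {x z : ℕ → ℝ} {J l : ℝ} (hJ : 1 ≤ J)
    (hx : ∀ k : ℕ, x (k + 1) = (k + 1) / (k + 1 + J) * x k + z k / (k + 1 + J))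
    (hz : Tendsto z atTop (𝓝 l)) : Tendsto x atTop (𝓝 (l / J)) := by
  have hJ0 : J ≠ 0 := by linarith
  set e : ℕ → ℝ := fun k => x k - l / J with he
  have hrec : ∀ k : ℕ, (k + 1 + J) * e (k + 1) = (k + 1) * e k + (z k - l) := by
    intro k
    have : (k : ℝ) + 1 + J ≠ 0 := by positivity
    simp only [he, hx]
    field_simp
    ring
  have hbound : ∀ k : ℕ, (k + 1) * |e k| ≤ |e 0| + ∑ i ∈ Finset.range k, |z i - l| := by
    intro k
    induction k with
    | zero => simp
    | succ k ih =>
      rw [Finset.sum_range_succ]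
      have h1 : (k + 1 + J) * |e (k + 1)| ≤ (k + 1) * |e k| + |z k - l| := by
        have h2 : |((k : ℝ) + 1 + J) * e (k + 1)| = (k + 1 + J) * |e (k + 1)| := by
          rw [abs_mul, abs_of_pos (by positivity)]
        have h3 : |((k : ℝ) + 1) * e k| = (k + 1) * |e k| := by
          rw [abs_mul, abs_of_pos (by positivity)]
        rw [← h2, hrec, ← h3]
        exact abs_add_le _ _
      push_cast
      nlinarith [abs_nonneg (e (k + 1))]
  have hces : Tendsto (fun n : ℕ => (n⁻¹ : ℝ) * ∑ i ∈ Finset.range n, |z i - l|) atTop (𝓝 0) := by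
    refine Filter.Tendsto.cesaro ?_
    have := (hz.sub_const l).abs
    simpa using this
  have hzero : Tendsto (fun n : ℕ => |e 0| * (n⁻¹ : ℝ) +
      (n⁻¹ : ℝ) * ∑ i ∈ Finset.range n, |z i - l|) atTop (𝓝 0) := by
    have := (tendsto_inv_atTop_nhds_zero_nat (𝕜 := ℝ)).const_mul |e 0|
    simpa using this.add hces
  have hlim : Tendsto e atTop (𝓝 0) := by
    refine squeeze_zero_norm' ?_ hzero
    filter_upwards [eventually_gt_atTop 0] with k hk
    have hk' : (0 : ℝ) < k := by exact_mod_cast hk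
    rw [Real.norm_eq_abs, mul_comm |e 0|, ← mul_add, inv_mul_eq_div, le_div_iff₀ hk']
    have := hbound k
    nlinarith [abs_nonneg (e k)]
  have := hlim.add_const (l / J)
  simpa [he] using this

/-- `forestRatio_succ_succ` is the averaging recurrence with J = j + 1 and zₖ = (1 + j/(k + 2))
`forestRatio (k + 1) j`, so each step in j divides the limit by j + 1. -/
theorem tendsto_forestRatio (j : ℕ) :
    Tendsto (fun k => forestRatio k j) atTop (𝓝 (1 / j.factorial)) := by
  induction j with
  | zero => simp [forestRatio_zero_right]
  | succ j ih =>
    have hz : Tendsto (fun k : ℕ => (1 + j * ((k + 2 : ℕ) : ℝ)⁻¹) * forestRatio (k + 1) j) atTop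
        (𝓝 ((1 + j * 0) * (1 / j.factorial))) := by
      refine Tendsto.mul (tendsto_const_nhds.add (Tendsto.const_mul _ ?_))
        ((tendsto_add_atTop_iff_nat 1).2 ih)
      exact (tendsto_add_atTop_iff_nat (f := fun k : ℕ => ((k : ℝ))⁻¹) 2).2
        tendsto_inv_atTop_nhds_zero_nat
    have hJ : (1 : ℝ) ≤ j + 1 := by linarith [Nat.cast_nonneg (α := ℝ) j]
    have := tendsto_of_averaging_recurrence (x := fun k => forestRatio k (j + 1)) hJ (fun k => ?_) hz
    · convert this using 2
      rw [Nat.factorial_succ]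
      push_cast
      field_simp
      ring
    · simp only [forestRatio_succ_succ]
      push_cast
      have h1 : (k : ℝ) + j + 2 ≠ 0 := by positivity
      have h2 : (k : ℝ) + 1 + (j + 1) ≠ 0 := by positivity
      field_simp
      ring

/-- The decomposition count in m + 2 symbols divided by (m + 1)!; j is the excess of symbols over
trees. -/
theorem sum_primeRatio_mul_forestRatio (m : ℕ) :
    ∑ j ∈ Finset.range (m + 2), primeRatio (m + 1 - j) * forestRatio (m + 1 - j) j = 1 := by
  have h := numOrderedBrackets_eq_sum (n := m + 2) (by omega)
  rw [Finset.sum_range_succ', numPrimeBrackets_zero, zero_mul, add_zero, numOrderedBrackets,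
    if_neg (by omega), show m + 2 - 1 = m + 1 by omega] at h
  have h' : ((m + 1).factorial : ℝ) = ∑ k ∈ Finset.range (m + 2),
      (numPrimeBrackets (k + 1) : ℝ) * coeff (m + 2) (orderedSeries ℝ ^ (k + 1)) := by
    rw [h]
    push_cast
    refine Finset.sum_congr rfl fun k _ => ?_
    rw [coeff_orderedSeries_pow_cast]
  rw [← Finset.sum_range_reflect] at h'
  have hm : ((m + 1).factorial : ℝ) ≠ 0 := by positivity
  refine mul_left_cancel₀ hm ?_
  rw [mul_one, Finset.mul_sum]
  conv_rhs => rw [h']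
  refine Finset.sum_congr rfl fun j hj => ?_
  rw [Finset.mem_range] at hj
  rw [show m + 2 - 1 - j = m + 1 - j by omega, numPrimeBrackets_succ, forestRatio,
    show m + 1 - j + 1 + j = m + 2 by omega, show m + 1 - j + j = m + 1 by omega]
  field_simp

theorem primeRatio_limit {c : ℝ} (h : Tendsto primeRatio atTop (𝓝 c)) : c = Real.exp (-1) := by
  -- Cutting at j < m keeps the row index at least 2, where the majorant applies. Of the omitted
  -- terms, j = m + 1 vanishes and j = m tends to 0.
  set u : ℕ → ℕ → ℝ := fun m j =>
    if j < m then primeRatio (m + 1 - j) * forestRatio (m + 1 - j) j else 0 with hu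
  have hsum : ∀ m, ∑' j, u m j = 1 - primeRatio 1 * forestRatio 1 m := by
    intro m
    rw [tsum_eq_sum (s := Finset.range m)]
    · have := sum_primeRatio_mul_forestRatio m
      rw [Finset.sum_range_succ, Finset.sum_range_succ, show m + 1 - (m + 1) = 0 by omega,
        show m + 1 - m = 1 by omega, primeRatio_zero, zero_mul, add_zero] at this
      rw [← this, add_sub_cancel_right]
      refine Finset.sum_congr rfl fun j hj => ?_
      rw [hu]
      exact if_pos (Finset.mem_range.1 hj)
    · intro j hj
      rw [hu]
      exact if_neg fun h => hj (Finset.mem_range.2 h)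
  have hlim1 : Tendsto (fun m => ∑' j, u m j) atTop (𝓝 (1 - primeRatio 1 * 0)) := by
    simp only [hsum]
    refine tendsto_const_nhds.sub (Tendsto.const_mul _ ?_)
    refine squeeze_zero (fun m => forestRatio_nonneg 1 m) forestRatio_one_le ?_
    have := (tendsto_one_div_add_atTop_nhds_zero_nat (𝕜 := ℝ)).const_mul 4
    simpa [div_eq_mul_inv] using this
  have hbs : Summable fun j : ℕ => 24 / (((j : ℝ) + 1) * (j + 2)) := by
    have h2 : Summable fun j : ℕ => 24 * (1 / (((j + 1 : ℕ) : ℝ)) ^ 2) :=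
      ((summable_nat_add_iff 1).2 (Real.summable_one_div_nat_pow.2 one_lt_two)).mul_left 24
    refine h2.of_nonneg_of_le (fun j => by positivity) fun j => ?_
    rw [mul_one_div]
    push_cast
    gcongr
    nlinarith [Nat.cast_nonneg (α := ℝ) j]
  have hlim2 : Tendsto (fun m => ∑' j, u m j) atTop (𝓝 (∑' j : ℕ, c * (1 / j.factorial))) := by
    refine tendsto_tsum_of_dominated_convergence hbs (fun j => ?_) (Eventually.of_forall ?_)
    · have h1 : Tendsto (fun m : ℕ => m + 1 - j) atTop atTop :=
        (tendsto_sub_atTop_nat j).comp (tendsto_add_atTop_nat 1)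
      refine ((h.comp h1).mul ((tendsto_forestRatio j).comp h1)).congr' ?_
      filter_upwards [eventually_gt_atTop j] with m hm
      exact (if_pos hm).symm
    · intro m j
      rw [hu, Real.norm_eq_abs]
      dsimp only
      split_ifs with hjm
      · obtain ⟨k, hk⟩ : ∃ k, m + 1 - j = k + 2 := ⟨m + 1 - j - 2, by omega⟩
        rw [hk, abs_of_nonneg (mul_nonneg (primeRatio_nonneg _) (forestRatio_nonneg _ _))]
        calc _ ≤ 1 * forestRatio (k + 2) j :=
              mul_le_mul_of_nonneg_right (primeRatio_le_one _) (forestRatio_nonneg _ _)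
          _ ≤ _ := by rw [one_mul]; exact forestRatio_le k j
      · rw [abs_zero]; positivity
  have hexp : ∑' j : ℕ, c * (1 / (j.factorial : ℝ)) = c * Real.exp 1 := by
    rw [tsum_mul_left, Real.exp_eq_exp_ℝ, NormedSpace.exp_eq_tsum_div]
    simp
  have := tendsto_nhds_unique hlim1 hlim2
  rw [hexp, mul_zero, sub_zero] at this
  rw [Real.exp_neg]
  exact eq_inv_of_mul_eq_one_left this.symm

end Constant

/-! ### Linearizing the recurrence -/

section Recurrence

open PowerSeries Finset.HasAntidiagonal

theorem sum_antidiagonal_peel {M : Type*} [AddCommMonoid M] (m : ℕ) (f : ℕ → ℕ → M) :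
    ∑ p ∈ antidiagonal (m + 2), f p.1 p.2 =
      f 0 (m + 2) + f (m + 2) 0 + ∑ p ∈ antidiagonal m, f (p.1 + 1) (p.2 + 1) := by
  rw [Finset.Nat.sum_antidiagonal_succ, Finset.Nat.sum_antidiagonal_succ']
  exact (add_assoc _ _ _).symm

theorem factorial_add_mul_factorial_add_le (s i j : ℕ) :
    (s + i).factorial * (s + j).factorial ≤ s.factorial * (s + (i + j)).factorial := by
  induction i with
  | zero => simp
  | succ i ih =>
    rw [show s + (i + 1) = (s + i) + 1 by ring, show s + (i + 1 + j) = (s + (i + j)) + 1 by ring,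
      Nat.factorial_succ, Nat.factorial_succ]
    calc (s + i + 1) * (s + i).factorial * (s + j).factorial
        = (s + i + 1) * ((s + i).factorial * (s + j).factorial) := by ring
      _ ≤ (s + (i + j) + 1) * (s.factorial * (s + (i + j)).factorial) := by
          gcongr
          omega
      _ = _ := by ring

/-- The two end terms give 2 · s! (s + m)!. By log-convexity each of the m - 1 inner terms is at
most (s + 1)! (s + m - 1)!, together at most (s + 1)! (s + m)!. -/
theorem sum_antidiagonal_factorial_le (s m : ℕ) :
    ∑ p ∈ antidiagonal m, (s + p.1).factorial * (s + p.2).factorial ≤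
      (2 * s.factorial + (s + 1).factorial) * (s + m).factorial := by
  rcases m with _ | _ | m
  · have h0 : antidiagonal 0 = {((0 : ℕ), (0 : ℕ))} := rfl
    rw [h0, Finset.sum_singleton, add_zero]
    gcongr
    omega
  · rw [zero_add, Finset.Nat.sum_antidiagonal_succ]
    have h0 : antidiagonal 0 = {((0 : ℕ), (0 : ℕ))} := rfl
    rw [h0, Finset.sum_singleton]
    simp only [add_zero, zero_add]
    nlinarith [Nat.zero_le ((s + 1).factorial * (s + 1).factorial)]
  · rw [sum_antidiagonal_peel m fun i j => (s + i).factorial * (s + j).factorial]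
    have h1 : ∑ p ∈ antidiagonal m, (s + (p.1 + 1)).factorial * (s + (p.2 + 1)).factorial ≤
        ∑ p ∈ antidiagonal m, (s + 1).factorial * (s + 1 + m).factorial := by
      refine Finset.sum_le_sum fun p hp => ?_
      have := factorial_add_mul_factorial_add_le (s + 1) p.1 p.2
      rw [Finset.HasAntidiagonal.mem_antidiagonal.1 hp] at this
      rwa [add_comm p.1, add_comm p.2, ← add_assoc, ← add_assoc]
    rw [Finset.sum_const, Finset.Nat.card_antidiagonal, smul_eq_mul] at h1
    have h2 : (m + 1) * (s + 1 + m).factorial ≤ (s + (m + 2)).factorial := by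
      rw [show s + (m + 2) = (s + 1 + m) + 1 by ring, Nat.factorial_succ]
      gcongr
      omega
    simp only [add_zero]
    calc _ ≤ s.factorial * (s + (m + 2)).factorial + (s + (m + 2)).factorial * s.factorial +
          (s + 1).factorial * (s + (m + 2)).factorial := by
          refine Nat.add_le_add_left (h1.trans ?_) _
          calc (m + 1) * ((s + 1).factorial * (s + 1 + m).factorial)
              = (s + 1).factorial * ((m + 1) * (s + 1 + m).factorial) := by ring
            _ ≤ _ := Nat.mul_le_mul_left _ h2
      _ = _ := by ring

/-- The number of prime expressions, shifted by one. -/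
noncomputable def primeCount (n : ℕ) : ℝ := numPrimeBrackets (n + 1)

theorem primeCount_nonneg (n : ℕ) : 0 ≤ primeCount n := Nat.cast_nonneg _

theorem primeCount_le (n : ℕ) : primeCount n ≤ n.factorial := by
  rw [primeCount]
  exact_mod_cast numPrimeBrackets_le (n + 1)

theorem primeCount_zero : primeCount 0 = 0 := by simp [primeCount, numPrimeBrackets_one]

theorem primeConvolution_add_two (n : ℕ) : primeConvolution (n + 2) =
    ∑ p ∈ antidiagonal n, primeCount p.1 * primeCount p.2 := by
  rw [primeConvolution, coeff_mul,
    sum_antidiagonal_peel n fun i j => coeff i primeSeries * coeff j primeSeries]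
  simp only [coeff_primeSeries, numPrimeBrackets_zero, Nat.cast_zero, zero_mul, mul_zero, zero_add]
  rfl

theorem primeCount_recurrence (n : ℕ) : primeCount (n + 2) =
    (n + 4) / 2 * (∑ p ∈ antidiagonal (n + 2), primeCount p.1 * primeCount p.2) -
      2 * primeCount (n + 1) + ∑ p ∈ antidiagonal (n + 1), primeCount p.1 * primeCount p.2 := by
  rw [← primeConvolution_add_two, ← primeConvolution_add_two]
  exact numPrimeBrackets_recurrence n

theorem primeCount_one : primeCount 1 = 1 := by
  have h := numOrderedBrackets_eq_sum (n := 2) le_rfl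
  simp only [Finset.sum_range_succ, Finset.sum_range_zero, numPrimeBrackets_zero,
    numPrimeBrackets_one, zero_mul, zero_add] at h
  have h1 : (coeff 2 (orderedSeries ℕ ^ 2) : ℕ) = 1 := by
    rw [pow_two, coeff_mul, Finset.Nat.sum_antidiagonal_eq_sum_range_succ_mk]
    simp [Finset.sum_range_succ, coeff_orderedSeries, numOrderedBrackets]
  rw [h1, mul_one] at h
  rw [primeCount, ← h]
  simp [numOrderedBrackets]

theorem primeCount_two : primeCount 2 = 0 := by
  have h := primeCount_recurrence 0
  simp only [Finset.Nat.sum_antidiagonal_eq_sum_range_succ_mk, Finset.sum_range_succ,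
    Finset.sum_range_zero, primeCount_zero, primeCount_one] at h
  norm_num [primeCount_zero, primeCount_one] at h
  exact h

theorem primeCount_three : primeCount 3 = 1 := by
  have h := primeCount_recurrence 1
  simp only [Finset.Nat.sum_antidiagonal_eq_sum_range_succ_mk, Finset.sum_range_succ,
    Finset.sum_range_zero] at h
  norm_num [primeCount_zero, primeCount_one, primeCount_two] at h
  exact h

theorem primeCount_four : primeCount 4 = 4 := by
  have h := primeCount_recurrence 2
  simp only [Finset.Nat.sum_antidiagonal_eq_sum_range_succ_mk, Finset.sum_range_succ,
    Finset.sum_range_zero] at h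
  norm_num [primeCount_zero, primeCount_one, primeCount_two, primeCount_three] at h
  exact h

theorem exists_sum_antidiagonal_primeCount_le (s : ℕ) : ∃ K : ℝ, ∀ m,
    ∑ p ∈ antidiagonal m, primeCount (p.1 + s) * primeCount (p.2 + s) ≤
      K * (m + s).factorial := by
  refine ⟨((2 * s.factorial + (s + 1).factorial : ℕ) : ℝ), fun m => ?_⟩
  have h : ((∑ p ∈ antidiagonal m, (s + p.1).factorial * (s + p.2).factorial : ℕ) : ℝ) ≤
      (((2 * s.factorial + (s + 1).factorial) * (s + m).factorial : ℕ) : ℝ) :=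
    Nat.cast_le.2 (sum_antidiagonal_factorial_le s m)
  rw [Nat.cast_mul, Nat.cast_sum, add_comm s m] at h
  refine le_trans (Finset.sum_le_sum fun _ _ => ?_) h
  rw [add_comm _ s, add_comm _ s, Nat.cast_mul]
  exact mul_le_mul (primeCount_le _) (primeCount_le _) (primeCount_nonneg _) (Nat.cast_nonneg _)

theorem sum_antidiagonal_primeCount_nonneg (s m : ℕ) :
    0 ≤ ∑ p ∈ antidiagonal m, primeCount (p.1 + s) * primeCount (p.2 + s) :=
  Finset.sum_nonneg fun _ _ => mul_nonneg (primeCount_nonneg _) (primeCount_nonneg _)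

/-- Peel five terms off each end of the first convolution and three off the second, with initial
values 0, 1, 0, 1, 4. The coefficient m + 10 is (m + 12) - 2. The first remainder is O((m + 5)!)
with a factor (m + 12)/2, the second O((m + 6)!). -/
theorem exists_primeCount_expansion : ∃ K : ℝ, ∀ m : ℕ,
    |primeCount (m + 10) - ((m + 10) * primeCount (m + 9) + 2 * primeCount (m + 8) +
      (m + 12) * primeCount (m + 7) + 4 * (m + 12) * primeCount (m + 6))| ≤
      K * (m + 6).factorial := by
  obtain ⟨K5, hK5⟩ := exists_sum_antidiagonal_primeCount_le 5
  obtain ⟨K3, hK3⟩ := exists_sum_antidiagonal_primeCount_le 3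
  refine ⟨K5 + K3, fun m => ?_⟩
  have h := primeCount_recurrence (m + 8)
  have e1 : ∑ p ∈ antidiagonal (m + 8 + 2), primeCount p.1 * primeCount p.2 =
      2 * primeCount (m + 9) + 2 * primeCount (m + 7) + 8 * primeCount (m + 6) +
        ∑ p ∈ antidiagonal m, primeCount (p.1 + 5) * primeCount (p.2 + 5) := by
    rw [sum_antidiagonal_peel (m + 8) fun i j => primeCount i * primeCount j,
      sum_antidiagonal_peel (m + 6) fun i j => primeCount (i + 1) * primeCount (j + 1),
      sum_antidiagonal_peel (m + 4) fun i j => primeCount (i + 1 + 1) * primeCount (j + 1 + 1),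
      sum_antidiagonal_peel (m + 2) fun i j =>
        primeCount (i + 1 + 1 + 1) * primeCount (j + 1 + 1 + 1),
      sum_antidiagonal_peel m fun i j =>
        primeCount (i + 1 + 1 + 1 + 1) * primeCount (j + 1 + 1 + 1 + 1)]
    simp only [zero_add, add_assoc, Nat.reduceAdd, primeCount_zero, primeCount_one, primeCount_two,
      primeCount_three, primeCount_four]
    ring
  have e2 : ∑ p ∈ antidiagonal (m + 8 + 1), primeCount p.1 * primeCount p.2 =
      2 * primeCount (m + 8) +
        ∑ p ∈ antidiagonal (m + 3), primeCount (p.1 + 3) * primeCount (p.2 + 3) := by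
    rw [show m + 8 + 1 = m + 3 + 4 + 2 by ring,
      sum_antidiagonal_peel (m + 3 + 4) fun i j => primeCount i * primeCount j,
      sum_antidiagonal_peel (m + 3 + 2) fun i j => primeCount (i + 1) * primeCount (j + 1),
      sum_antidiagonal_peel (m + 3) fun i j => primeCount (i + 1 + 1) * primeCount (j + 1 + 1)]
    simp only [zero_add, add_assoc, Nat.reduceAdd, primeCount_zero, primeCount_one, primeCount_two]
    ring
  have h5 := sum_antidiagonal_primeCount_nonneg 5 m
  have h3 := sum_antidiagonal_primeCount_nonneg 3 (m + 3)
  have h5' := hK5 m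
  have h3' := hK3 (m + 3)
  rw [e1, e2] at h
  set R5 := ∑ p ∈ antidiagonal m, primeCount (p.1 + 5) * primeCount (p.2 + 5)
  set R3 := ∑ p ∈ antidiagonal (m + 3), primeCount (p.1 + 3) * primeCount (p.2 + 3)
  clear_value R5 R3
  rw [show m + 3 + 3 = m + 6 by ring] at h3'
  have hdiff : primeCount (m + 10) - ((m + 10) * primeCount (m + 9) + 2 * primeCount (m + 8) +
      (m + 12) * primeCount (m + 7) + 4 * (m + 12) * primeCount (m + 6)) =
      (m + 12) / 2 * R5 + R3 := by
    rw [show m + 8 + 2 = m + 10 by ring, show m + 8 + 1 = m + 9 by ring] at h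
    push_cast at h
    linear_combination h
  rw [hdiff, abs_of_nonneg (add_nonneg (mul_nonneg (by positivity) h5) h3), add_mul]
  refine add_le_add ?_ h3'
  calc ((m : ℝ) + 12) / 2 * R5 ≤ (m + 6) * (K5 * (m + 5).factorial) := by
        gcongr
        linarith [Nat.cast_nonneg (α := ℝ) m]
    _ = K5 * (m + 6).factorial := by
        have f6 : ((m + 6).factorial : ℝ) = (m + 6) * (m + 5).factorial := by
          rw [Nat.factorial_succ (m + 5)]; push_cast; ring
        rw [f6]
        ring

theorem exists_primeRatio_expansion : ∃ K : ℝ, 0 ≤ K ∧ ∀ m : ℕ,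
    |primeRatio (m + 10) - primeRatio (m + 9) -
      (2 / ((m + 10) * (m + 9)) * primeRatio (m + 8) +
      (m + 12) / ((m + 10) * (m + 9) * (m + 8)) * primeRatio (m + 7) +
      4 * (m + 12) / ((m + 10) * (m + 9) * (m + 8) * (m + 7)) * primeRatio (m + 6))| ≤
      K / (m + 1) ^ 4 := by
  obtain ⟨K, hK⟩ := exists_primeCount_expansion
  have hK0 : 0 ≤ K := by
    have := (abs_nonneg _).trans (hK 0)
    exact nonneg_of_mul_nonneg_left this (by positivity)
  refine ⟨K, hK0, fun m => ?_⟩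
  have hc : ∀ n, primeCount n = n.factorial * primeRatio n := numPrimeBrackets_succ
  have h := hK m
  simp only [hc] at h
  have f7 : ((m + 7).factorial : ℝ) = (m + 7) * (m + 6).factorial := by
    rw [Nat.factorial_succ (m + 6)]; push_cast; ring
  have f8 : ((m + 8).factorial : ℝ) = (m + 8) * (m + 7).factorial := by
    rw [Nat.factorial_succ (m + 7)]; push_cast; ring
  have f9 : ((m + 9).factorial : ℝ) = (m + 9) * (m + 8).factorial := by
    rw [Nat.factorial_succ (m + 8)]; push_cast; ring
  have f10 : ((m + 10).factorial : ℝ) = (m + 10) * (m + 9).factorial := by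
    rw [Nat.factorial_succ (m + 9)]; push_cast; ring
  rw [f10, f9, f8, f7] at h
  have hf : (0 : ℝ) < (m + 6).factorial := by positivity
  set f : ℝ := ((m + 6).factorial : ℝ)
  set P : ℝ := (m + 10) * (m + 9) * (m + 8) * (m + 7) with hP
  have hP0 : 0 < P := by positivity
  set D := primeRatio (m + 10) - primeRatio (m + 9) -
      (2 / ((m + 10) * (m + 9)) * primeRatio (m + 8) +
      (m + 12) / ((m + 10) * (m + 9) * (m + 8)) * primeRatio (m + 7) +
      4 * (m + 12) / P * primeRatio (m + 6)) with hD
  have hDP : |P * f * D| ≤ K * f := by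
    convert h using 2
    rw [hD, hP]
    field_simp
    ring
  rw [abs_mul, abs_of_pos (mul_pos hP0 hf)] at hDP
  have h2 : P * |D| ≤ K := by
    refine le_of_mul_le_mul_right ?_ hf
    linarith
  have h3 : |D| ≤ K / P := by
    rw [le_div_iff₀ hP0]; linarith
  refine h3.trans ?_
  gcongr
  rw [hP]
  have hm : (0 : ℝ) ≤ m := Nat.cast_nonneg m
  calc ((m : ℝ) + 1) ^ 4 = (m + 1) * (m + 1) * (m + 1) * (m + 1) := by ring
    _ ≤ _ := by gcongr <;> norm_num

end Recurrence

/-! ### Convergence and bootstrapping of the expansion -/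

section Asymptotics

open Filter Topology Asymptotics

/-- The comparison sequence `(m + 1) ^ (-p)`. -/
noncomputable def invPow (p : ℕ) (m : ℕ) : ℝ := 1 / ((m : ℝ) + 1) ^ p

theorem invPow_pos (p m : ℕ) : 0 < invPow p m := by rw [invPow]; positivity

theorem isBigO_invPow_iff {f : ℕ → ℝ} {p : ℕ} :
    f =O[⊤] invPow p ↔ ∃ C, ∀ m, |f m| ≤ C * invPow p m := by
  rw [isBigO_top]
  simp only [Real.norm_eq_abs, abs_of_pos (invPow_pos _ _)]

theorem isBigO_invPow_of_le {f : ℕ → ℝ} {p : ℕ} (C : ℝ)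
    (h : ∀ m : ℕ, |f m| ≤ C / ((m : ℝ) + 1) ^ p) : f =O[⊤] invPow p :=
  isBigO_invPow_iff.2 ⟨C, fun m => (h m).trans_eq (by rw [invPow, mul_one_div])⟩

theorem invPow_mul (p q m : ℕ) : invPow p m * invPow q m = invPow (p + q) m := by
  rw [invPow, invPow, invPow, pow_add, div_mul_div_comm, one_mul]

theorem isBigO_invPow_mul {f g : ℕ → ℝ} {p q : ℕ} (hf : f =O[⊤] invPow p) (hg : g =O[⊤] invPow q) :
    (fun m => f m * g m) =O[⊤] invPow (p + q) :=
  (hf.mul hg).congr_right (invPow_mul p q)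

theorem isBigO_invPow_mono {f : ℕ → ℝ} {p q : ℕ} (h : q ≤ p) (hf : f =O[⊤] invPow p) :
    f =O[⊤] invPow q := by
  refine hf.trans (isBigO_invPow_of_le 1 fun m => ?_)
  rw [abs_of_pos (invPow_pos _ _), invPow]
  gcongr
  linarith [Nat.cast_nonneg (α := ℝ) m]

theorem isBigO_invPow_shift {f : ℕ → ℝ} {p : ℕ} (k : ℕ) (hf : f =O[⊤] invPow p) :
    (fun m => f (m + k)) =O[⊤] invPow p := by
  refine (hf.comp_tendsto (tendsto_top (f := fun m => m + k))).trans
    (isBigO_invPow_of_le 1 fun m => ?_)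
  rw [Function.comp_apply, abs_of_pos (invPow_pos _ _), invPow]
  push_cast
  gcongr
  linarith [Nat.cast_nonneg (α := ℝ) k]

/-- Over `⊤` the bound must hold at every index, so the constant absorbs the skipped initial values;
2ᵖ pays for each unit shift. -/
theorem isBigO_invPow_of_shift {f : ℕ → ℝ} {p : ℕ} (k : ℕ)
    (hf : (fun m => f (m + k)) =O[⊤] invPow p) : f =O[⊤] invPow p := by
  induction k with
  | zero => exact hf
  | succ k ih =>
    refine ih ?_
    obtain ⟨C, hC⟩ := isBigO_invPow_iff.1 hf
    refine isBigO_invPow_of_le (max |f k| (C * 2 ^ p)) fun m => ?_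
    rcases m with _ | m
    · simp
    · have h1 := hC m
      rw [show m + (k + 1) = m + 1 + k by ring] at h1
      have hC0 : 0 ≤ C := nonneg_of_mul_nonneg_left ((abs_nonneg _).trans h1) (invPow_pos p m)
      refine h1.trans ?_
      calc C * invPow p m = C * 2 ^ p / (2 * (m + 1)) ^ p := by
            rw [invPow, mul_pow]; field_simp
        _ ≤ max |f k| (C * 2 ^ p) / (((m + 1 : ℕ) : ℝ) + 1) ^ p := by
            gcongr
            · exact le_max_right _ _
            · push_cast; linarith [Nat.cast_nonneg (α := ℝ) m]

/-- With a = 1/(m + 2), a(1 + a) ≤ 1/(m + 1) makes the difference at least aᵖ⁺¹, while 1/(m + 1) ≤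
2a. -/
theorem invPow_succ_le_sub {p : ℕ} (hp : 1 ≤ p) (m : ℕ) :
    invPow (p + 1) m ≤ 2 ^ (p + 1) * (invPow p m - invPow p (m + 1)) := by
  have hm : (0 : ℝ) ≤ m := Nat.cast_nonneg m
  set a : ℝ := 1 / ((m : ℝ) + 2) with ha
  have ha0 : 0 ≤ a := by positivity
  have h1 : invPow p (m + 1) = a ^ p := by
    rw [invPow, ha, one_div_pow]; push_cast; ring_nf
  have h2 : a ^ p * (1 + a) ≤ invPow p m := by
    have h3 : a * (1 + a) ≤ 1 / ((m : ℝ) + 1) := by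
      have : a * (1 + a) = (m + 3) / (m + 2) ^ 2 := by
        rw [ha]; field_simp; ring
      rw [this, div_le_div_iff₀ (by positivity) (by positivity)]
      nlinarith
    calc a ^ p * (1 + a) ≤ a ^ p * (1 + a) ^ p := by
          gcongr
          exact le_self_pow₀ (by linarith) (by omega)
      _ = (a * (1 + a)) ^ p := (mul_pow _ _ _).symm
      _ ≤ (1 / ((m : ℝ) + 1)) ^ p := by gcongr
      _ = invPow p m := by rw [invPow, one_div_pow]
  have h4 : invPow (p + 1) m ≤ 2 ^ (p + 1) * a ^ (p + 1) := by
    rw [invPow, ← one_div_pow, ← mul_pow]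
    gcongr
    rw [ha, mul_one_div, div_le_div_iff₀ (by positivity) (by positivity)]
    linarith
  refine h4.trans ?_
  gcongr
  rw [h1, pow_succ]
  linarith

/-- A null sequence whose increments decay like `m ^ (-(p + 1))` decays like `m ^ (-p)`. -/
theorem isBigO_invPow_of_increment {x : ℕ → ℝ} {p : ℕ} (hp : 1 ≤ p)
    (hx : Tendsto x atTop (𝓝 0)) (h : (fun m => x (m + 1) - x m) =O[⊤] invPow (p + 1)) :
    x =O[⊤] invPow p := by
  obtain ⟨C, hC⟩ := isBigO_invPow_iff.1 h
  have hC0 : 0 ≤ C := nonneg_of_mul_nonneg_left ((abs_nonneg _).trans (hC 0)) (invPow_pos _ 0)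
  set D := C * 2 ^ (p + 1) with hD
  have hstep : ∀ m, |x (m + 1) - x m| ≤ D * (invPow p m - invPow p (m + 1)) := fun m =>
    (hC m).trans ((mul_le_mul_of_nonneg_left (invPow_succ_le_sub hp m) hC0).trans_eq
      (by rw [hD]; ring))
  have hlim : Tendsto (invPow p) atTop (𝓝 0) := by
    have := (tendsto_one_div_add_atTop_nhds_zero_nat (𝕜 := ℝ)).pow p
    rw [zero_pow (by omega)] at this
    refine this.congr fun m => ?_
    rw [invPow, one_div_pow]
  refine isBigO_invPow_iff.2 ⟨D, fun m => abs_le.2 ⟨?_, ?_⟩⟩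
  -- The increments of x are dominated by those of `D * invPow p`, so x plus (minus) this sequence
  -- decreases (increases) to 0, which fixes its sign.
  · have hanti : Antitone fun m => x m + D * invPow p m := by
      refine antitone_nat_of_succ_le fun m => ?_
      have := (abs_le.1 (hstep m)).2
      linarith
    have := hanti.le_of_tendsto (by simpa using hx.add (hlim.const_mul D)) m
    linarith
  · have hmono : Monotone fun m => x m - D * invPow p m := by
      refine monotone_nat_of_le_succ fun m => ?_
      have := (abs_le.1 (hstep m)).1
      linarith
    have := hmono.ge_of_tendsto (by simpa using hx.sub (hlim.const_mul D)) m
    linarith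

theorem isBigO_coeff_one : (fun m : ℕ => 2 / (((m : ℝ) + 10) * (m + 9))) =O[⊤] invPow 2 := by
  refine isBigO_invPow_of_le 2 fun m => ?_
  rw [abs_of_nonneg (by positivity)]
  gcongr
  nlinarith [Nat.cast_nonneg (α := ℝ) m]

theorem isBigO_coeff_two :
    (fun m : ℕ => ((m : ℝ) + 12) / ((m + 10) * (m + 9) * (m + 8))) =O[⊤] invPow 2 := by
  refine isBigO_invPow_of_le 2 fun m => ?_
  have hm : (0 : ℝ) ≤ m := Nat.cast_nonneg m
  rw [abs_of_nonneg (by positivity), mul_assoc, ← div_div]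
  gcongr
  · rw [div_le_iff₀ (by positivity)]; linarith
  · nlinarith

theorem isBigO_coeff_three :
    (fun m : ℕ => 4 * ((m : ℝ) + 12) / ((m + 10) * (m + 9) * (m + 8) * (m + 7))) =O[⊤]
      invPow 3 := by
  refine isBigO_invPow_of_le 8 fun m => ?_
  have hm : (0 : ℝ) ≤ m := Nat.cast_nonneg m
  rw [abs_of_nonneg (by positivity), mul_assoc, mul_assoc, ← div_div]
  gcongr
  · rw [div_le_iff₀ (by positivity)]; linarith
  · calc ((m : ℝ) + 1) ^ 3 = (m + 1) * ((m + 1) * (m + 1)) := by ring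
      _ ≤ _ := by gcongr <;> norm_num

/-- The source of the coefficient -3: the two leading coefficients add up to 3/m², the leading
increment of 1 - 3/n. Here n is m + 10 and m + 11, as `primeRatio m` belongs to arity m + 1. -/
theorem isBigO_remainder_two : (fun m : ℕ => 2 / (((m : ℝ) + 10) * (m + 9)) +
    ((m : ℝ) + 12) / ((m + 10) * (m + 9) * (m + 8)) -
    ((1 - 3 / ((m : ℝ) + 11)) - (1 - 3 / ((m : ℝ) + 10)))) =O[⊤] invPow 3 := by
  refine isBigO_invPow_of_le 10 fun m => ?_
  have hm : (0 : ℝ) ≤ m := Nat.cast_nonneg m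
  have : 2 / (((m : ℝ) + 10) * (m + 9)) + ((m : ℝ) + 12) / ((m + 10) * (m + 9) * (m + 8)) -
      ((1 - 3 / ((m : ℝ) + 11)) - (1 - 3 / ((m : ℝ) + 10))) =
      (10 * m + 92) / (m + 11) / ((m + 8) * (m + 9) * (m + 10)) := by
    field_simp
    ring
  rw [this, abs_of_nonneg (by positivity)]
  gcongr
  · rw [div_le_iff₀ (by positivity)]; linarith
  · calc ((m : ℝ) + 1) ^ 3 = (m + 1) * (m + 1) * (m + 1) := by ring
      _ ≤ _ := by gcongr <;> norm_num

/-- The coefficient -5/2 is the one that cancels the m⁻³ terms. The last multiplier is already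
O(m⁻³), so it only meets the constant approximation 1. -/
theorem isBigO_remainder_three :
    (fun m : ℕ => 2 / (((m : ℝ) + 10) * (m + 9)) * (1 - 3 / ((m : ℝ) + 9)) +
    ((m : ℝ) + 12) / ((m + 10) * (m + 9) * (m + 8)) * (1 - 3 / ((m : ℝ) + 8)) +
    4 * ((m : ℝ) + 12) / ((m + 10) * (m + 9) * (m + 8) * (m + 7)) -
    ((1 - 3 / ((m : ℝ) + 11) - 5 / (2 * ((m : ℝ) + 11) ^ 2)) -
      (1 - 3 / ((m : ℝ) + 10) - 5 / (2 * ((m : ℝ) + 10) ^ 2)))) =O[⊤] invPow 4 := by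
  refine isBigO_invPow_of_le 100 fun m => ?_
  have hm : (0 : ℝ) ≤ m := Nat.cast_nonneg m
  have : 2 / (((m : ℝ) + 10) * (m + 9)) * (1 - 3 / ((m : ℝ) + 9)) +
      ((m : ℝ) + 12) / ((m + 10) * (m + 9) * (m + 8)) * (1 - 3 / ((m : ℝ) + 8)) +
      4 * ((m : ℝ) + 12) / ((m + 10) * (m + 9) * (m + 8) * (m + 7)) -
      ((1 - 3 / ((m : ℝ) + 11) - 5 / (2 * ((m : ℝ) + 11) ^ 2)) -
        (1 - 3 / ((m : ℝ) + 10) - 5 / (2 * ((m : ℝ) + 10) ^ 2))) =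
      (37 * m ^ 5 + 1737 * m ^ 4 + 32695 * m ^ 3 + 308391 * m ^ 2 + 1457476 * m + 2760720) /
        (2 * (m + 7) * (m + 8) ^ 2 * (m + 9) ^ 2) / ((m + 10) ^ 2 * (m + 11) ^ 2) := by
    field_simp
    ring
  rw [this, abs_of_nonneg (by positivity)]
  gcongr
  · rw [div_le_iff₀ (by positivity)]
    nlinarith [pow_nonneg hm 2, pow_nonneg hm 3, pow_nonneg hm 4, pow_nonneg hm 5]
  · calc ((m : ℝ) + 1) ^ 4 = (m + 1) ^ 2 * (m + 1) ^ 2 := by ring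
      _ ≤ _ := by gcongr <;> norm_num

theorem exists_primeRatio_increment : ∃ ε : ℕ → ℝ, ε =O[⊤] invPow 4 ∧ ∀ m : ℕ,
    primeRatio (m + 10) - primeRatio (m + 9) =
      2 / (((m : ℝ) + 10) * (m + 9)) * primeRatio (m + 8) +
      ((m : ℝ) + 12) / ((m + 10) * (m + 9) * (m + 8)) * primeRatio (m + 7) +
      4 * ((m : ℝ) + 12) / ((m + 10) * (m + 9) * (m + 8) * (m + 7)) * primeRatio (m + 6) + ε m := by
  obtain ⟨K, -, hK⟩ := exists_primeRatio_expansion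
  exact ⟨_, isBigO_invPow_of_le K hK, fun m => by ring⟩

theorem isBigO_primeRatio_shift (k : ℕ) : (fun m => primeRatio (m + k)) =O[⊤] invPow 0 := by
  refine isBigO_invPow_of_le 1 fun m => ?_
  rw [abs_of_nonneg (primeRatio_nonneg _), pow_zero, div_one]
  exact primeRatio_le_one _

theorem isBigO_primeRatio_increment :
    (fun m => primeRatio (m + 10) - primeRatio (m + 9)) =O[⊤] invPow 2 := by
  obtain ⟨ε, hε, h⟩ := exists_primeRatio_increment
  simp only [h]
  exact (((isBigO_invPow_mul isBigO_coeff_one (isBigO_primeRatio_shift 8)).add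
    (isBigO_invPow_mul isBigO_coeff_two (isBigO_primeRatio_shift 7))).add
    (isBigO_invPow_mono (by norm_num)
      (isBigO_invPow_mul isBigO_coeff_three (isBigO_primeRatio_shift 6)))).add
    (isBigO_invPow_mono (by norm_num) hε)

theorem tendsto_primeRatio : Tendsto primeRatio atTop (𝓝 (Real.exp (-1))) := by
  obtain ⟨C, hC⟩ := isBigO_invPow_iff.1 isBigO_primeRatio_increment
  have hs : Summable fun m => C * invPow 2 m := by
    refine Summable.mul_left C ?_
    have := (summable_nat_add_iff 1).2 (Real.summable_one_div_nat_pow.2 one_lt_two)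
    refine this.congr fun m => ?_
    rw [invPow]; push_cast; rfl
  have hcauchy : CauchySeq fun m => primeRatio (m + 9) := by
    refine cauchySeq_of_dist_le_of_summable _ (fun m => ?_) hs
    rw [dist_comm, Real.dist_eq, show m.succ + 9 = m + 10 by omega]
    exact hC m
  obtain ⟨c, hc⟩ := cauchySeq_tendsto_of_complete hcauchy
  have hc' : Tendsto primeRatio atTop (𝓝 c) := (tendsto_add_atTop_iff_nat 9).1 hc
  rwa [← primeRatio_limit hc']

theorem isBigO_primeRatio_sub : (fun m => primeRatio m - Real.exp (-1)) =O[⊤] invPow 1 := by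
  refine isBigO_invPow_of_shift 9 (isBigO_invPow_of_increment le_rfl ?_ ?_)
  · have := ((tendsto_add_atTop_iff_nat 9).2 tendsto_primeRatio).sub_const (Real.exp (-1))
    simpa using this
  · refine isBigO_primeRatio_increment.congr_left fun m => ?_
    rw [show m + 1 + 9 = m + 10 by ring]; ring

theorem tendsto_const_div_add (a k : ℝ) :
    Tendsto (fun m : ℕ => a / ((m : ℝ) + k)) atTop (𝓝 0) :=
  tendsto_const_nhds.div_atTop (tendsto_atTop_add_const_right _ _ tendsto_natCast_atTop_atTop)

/-- Put r = e⁻¹ + O(1/m) into the two leading terms of the increment: the increments of the new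
error are O(m⁻³). -/
theorem isBigO_primeRatio_sub_two :
    (fun m : ℕ => primeRatio m - Real.exp (-1) * (1 - 3 / ((m : ℝ) + 1))) =O[⊤] invPow 2 := by
  refine isBigO_invPow_of_shift 9 (isBigO_invPow_of_increment (by norm_num) ?_ ?_)
  · have h1 := (tendsto_add_atTop_iff_nat 9).2 tendsto_primeRatio
    have h2 := (tendsto_add_atTop_iff_nat 9).2
      (((tendsto_const_div_add 3 1).const_sub 1).const_mul (Real.exp (-1)))
    simpa using h1.sub h2
  · obtain ⟨ε, hε, h⟩ := exists_primeRatio_increment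
    have e1 := isBigO_invPow_mul isBigO_coeff_one (isBigO_invPow_shift 8 isBigO_primeRatio_sub)
    have e2 := isBigO_invPow_mul isBigO_coeff_two (isBigO_invPow_shift 7 isBigO_primeRatio_sub)
    have e3 := isBigO_invPow_mul isBigO_coeff_three (isBigO_primeRatio_shift 6)
    have e4 := isBigO_invPow_mono (by norm_num : 3 ≤ 4) hε
    have e5 := isBigO_remainder_two.const_mul_left (Real.exp (-1))
    refine ((((e1.add e2).add e3).add e4).add e5).congr_left fun m => ?_
    have := h m
    rw [show m + 1 + 9 = m + 10 by ring]
    push_cast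
    rw [show (m : ℝ) + 10 + 1 = m + 11 by ring, show (m : ℝ) + 9 + 1 = m + 10 by ring]
    linear_combination -this

/-- The same step once more: an O(m⁻²) error meets coefficients O(m⁻²), and an O(m⁻¹) error meets
the O(m⁻³) one, so all increments of the error are O(m⁻⁴). -/
theorem isBigO_primeRatio_sub_three : (fun m : ℕ => primeRatio m -
    Real.exp (-1) * (1 - 3 / ((m : ℝ) + 1) - 5 / (2 * ((m : ℝ) + 1) ^ 2))) =O[⊤] invPow 3 := by
  refine isBigO_invPow_of_shift 9 (isBigO_invPow_of_increment (by norm_num) ?_ ?_)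
  · have h1 := (tendsto_add_atTop_iff_nat 9).2 tendsto_primeRatio
    have h3 := (((tendsto_const_div_add 1 1).pow 2).const_mul (5 / 2 : ℝ))
    have h2 := (tendsto_add_atTop_iff_nat 9).2
      ((((tendsto_const_div_add 3 1).const_sub 1).sub h3).const_mul (Real.exp (-1)))
    have h4 := h1.sub h2
    simp only [sub_zero, mul_one, ne_eq, OfNat.ofNat_ne_zero, not_false_eq_true, zero_pow, mul_zero,
      sub_self] at h4
    refine h4.congr fun m => ?_
    field_simp
  · obtain ⟨ε, hε, h⟩ := exists_primeRatio_increment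
    have e1 := isBigO_invPow_mul isBigO_coeff_one (isBigO_invPow_shift 8 isBigO_primeRatio_sub_two)
    have e2 := isBigO_invPow_mul isBigO_coeff_two (isBigO_invPow_shift 7 isBigO_primeRatio_sub_two)
    have e3 := isBigO_invPow_mul isBigO_coeff_three (isBigO_invPow_shift 6 isBigO_primeRatio_sub)
    have e5 := isBigO_remainder_three.const_mul_left (Real.exp (-1))
    refine ((((e1.add e2).add e3).add hε).add e5).congr_left fun m => ?_
    have := h m
    rw [show m + 1 + 9 = m + 10 by ring]
    push_cast
    rw [show (m : ℝ) + 10 + 1 = m + 11 by ring, show (m : ℝ) + 9 + 1 = m + 10 by ring,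
      show (m : ℝ) + 8 + 1 = m + 9 by ring, show (m : ℝ) + 7 + 1 = m + 8 by ring]
    linear_combination -this

end Asymptotics

theorem mainTheorem3 (R : Type*) [CommRing R] [Nontrivial R] :
    (∀ n : ℕ, 1 ≤ n →
      Module.Free R (lieOperad R n) ∧ Module.finrank R (lieOperad R n) = (n - 1).factorial ∧
      (primeBrackets n).Finite ∧
      ((primeBrackets n).ncard : ℝ) / (Module.finrank R (lieOperad R n) : ℝ) =
        (numPrimeBrackets n : ℝ) / ((n - 1).factorial : ℝ)) ∧
    (fun n : ℕ => (numPrimeBrackets n : ℝ) / ((n - 1).factorial : ℝ) -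
        Real.exp (-1) * (1 - 3 / (n : ℝ) - 5 / (2 * (n : ℝ) ^ 2)))
      =O[Filter.atTop] (fun n : ℕ => 1 / (n : ℝ) ^ 3) := by
  refine ⟨fun n hn => ?_, ?_⟩
  · obtain ⟨h1, h2⟩ := free_and_finrank_lieOperad R hn
    refine ⟨h1, h2, ?_, by rw [h2]; rfl⟩
    rw [primeBrackets_eq]
    exact (finite_and_ncard_orderedBracketsOn Finset.univ
      ⟨⟨0, hn⟩, Finset.mem_univ _⟩).1.subset fun t ht => ht.1
  · have h := (isBigO_primeRatio_sub_three.mono le_top).comp_tendsto (Filter.tendsto_sub_atTop_nat 1)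
    refine h.congr' ?_ ?_
    · filter_upwards [Filter.eventually_ge_atTop 1] with n hn
      obtain ⟨m, rfl⟩ : ∃ m, n = m + 1 := ⟨n - 1, by omega⟩
      simp only [Function.comp_apply, Nat.add_sub_cancel, primeRatio]
      push_cast
      rfl
    · filter_upwards [Filter.eventually_ge_atTop 1] with n hn
      obtain ⟨m, rfl⟩ : ∃ m, n = m + 1 := ⟨n - 1, by omega⟩
      simp only [Function.comp_apply, Nat.add_sub_cancel, invPow]
      push_cast
      rfl
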